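/- **Setting.** Let $\mathcal X,\mathcal A$ be finite non-empty sets, $N,T\ge 1$, $\ell\ge 0$, $0\le\alpha<1$, $\Psi\ge 0$, $\delta\in(0,1)$, let $p=(p_n)_{n\in[N]}$ be a transition kernel and $\rho\in\Delta_{\mathcal X\times\mathcal A}$. For a kernel $q$, a policy $\pi=(\pi_n)_{n\in[N]}$ and a distribution $\nu$ on $\mathcal X\times\mathcal A$ let $\mu^{\pi,q,\nu}_0=\nu$ and $\mu^{\pi,q,\nu}_{n}(x,a)=\sum_{x',a'}\mu^{\pi,q,\nu}_{n-1}(x',a')\,q_{n}(x|x',a')\,\pi_{n}(a|x)$ for $n\in[N]$, and put $\nu P_\pi=\mu^{\pi,p,\nu}_N$. A policy $\pi$ is periodic if $\rho P_\pi=\rho$. Assume that $\|\nu P_\pi-\nu'P_\pi\|_1\le\alpha\|\nu-\nu'\|_1$ for all periodic $\pi$ and all distributions $\nu,\nu'$. **Observations.** Let $\rho_1=\rho$ and $\rho_{t+1}=\rho_tP_{\pi_t}$, where $\pi_t$ is the policy played in episode $t$. There is a filtration $(\mathcal F_t)$ such that $\pi_t$ is $\mathcal F_t$-measurable and, given $\mathcal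 F_t$, the trajectory $(x_{t,n},a_{t,n})_{0\le n\le N}$ observed in episode $t$ is $\mathcal F_{t+1}$-measurable and has the law of a trajectory of the MDP with kernel $p$, policy $\pi_t$ and initial distribution $\rho_t$ (the observations are independent of the past). Let $N_{t,n}(x,a)$ be the number of $s<t$ with $(x_{s,n},a_{s,n})=(x,a)$; let $\hat p_{t,n+1}(\cdot|x,a)$ be the empirical frequencies of $x_{s,n+1}$ among these $s$, and the uniform distribution if $N_{t,n}(x,a)=0$. Put $\hat\mu_t^{\pi,\nu}=\mu^{\pi,\hat p_t,\nu}$, $\mu_t=\hat\mu_t^{\pi_t,\rho_t}$, and $$b_{t,n}=\frac{C_\delta}{\sqrt{\max\{1,N_{t,n}\}}},\qquad \bar b_{t,n}=\frac{\ell(N-n)C_\delta}{\sqrt{\max\{1,N_{t,n}\}}},\qquad C_\delta=\sqrt{2|\mathcal X|\log\frac{|\mathcal X||\mathcal A|NT}{\delta}} .$$ **Losses.** For $t\in[T]$, $n\in[N]$ the loss $f_{t,n}:\mathbb R^{\mathcal X\times\mathcal A}\to\mathbb R$ (possibly random) is convex and $\ell$-Lipschitz for $\|\cdot\|_1$, and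 $\ell_t=(\ell_{t,n})_{n\in[N]}$, where $\ell_{t,n}$ is a subgradient of $f_{t,n}$ at $\mu_{t,n}$ (the gradient, if it exists). **Algorithm.** Let $\mathcal M_t$ be the set of sequences $(\mu_n)_{0\le n\le N}$ of distributions on $\mathcal X\times\mathcal A$ with $\mu_0=\rho_t$ and $\sum_a\mu_{n}(x,a)=\sum_{x',a'}\mu_{n-1}(x',a')\,\hat p_{t,n}(x|x',a')$ for all $x$ and $n\in[N]$. The divergence $D_\psi(\mu,\mu')$ is either $\mathrm{KL}(\mu,\mu')=\sum_{n=0}^N\sum_{x,a}\mu_n\log\frac{\mu_n}{\mu_n'}$, with $\nabla\psi(\mu)_n(x,a)=1+\log\mu_n(x,a)$, or $\Gamma(\mu,\mu')=\sum_{n=1}^N\sum_{x,a}\mu_n(x,a)\log\frac{\pi_n(a|x)}{\pi'_n(a|x)}+\sum_{x,a}\mu_0\log\frac{\mu_0}{\mu_0'}$, where $\pi,\pi'$ are the policies of $\mu,\mu'$, with $\nabla\psi(\mu)_n(x,a)=\log\pi_n(a|x)$, for $n\in[N]$. The policy $\pi_1$ is arbitrary. For $1\le t<T$, provided that $\nabla\psi(\mu_t)$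 is defined and the constraint set below is non-empty, $$\mu_{t+1}\in\operatorname*{arg\,min}_{\mu\in\mathcal M_{t+1}}\ \eta\sum_{n=1}^N\langle\ell_{t,n}-\bar b_{t,n},\mu_n\rangle+D_\psi(\mu,\mu_t)\quad\text{s.t.}\quad\|\mu_N-\rho\|_1\le\sum_{n=0}^{N-1}\langle\mu_n,b_{t+1,n}\rangle+\alpha\|\rho_{t+1}-\rho\|_1 .$$ **Claim.** There are universal constants $C>0$ and $k\in\mathbb N$ such that, for all $\mathcal X,\mathcal A,N,T,\ell,\alpha,\Psi,\delta$ and either divergence, there is a step size $\eta>0$, depending only on these data, such that for all $p$, $\rho$, losses and runs as above there is an event of probability at least $1-3\delta$ on which the following holds. If, for all $t\in[T]$, $\nabla\psi(\mu_t)$ is defined (the arguments of its logarithms are positive) and $\|\nabla\psi(\mu_t)\|_{1,\infty}:=\sum_{n=1}^N\|\nabla\psi(\mu_t)_n\|_\infty\le\Psi$, then for every periodic policy $\pi$ $$\sum_{t=1}^T\sum_{n=1}^N\big\langle\ell_{t,n}-\bar b_{t,n},\,\mu_{t,n}-\hat\mu^{\pi,\rho_t}_{t,n}\big\rangle\ \le\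 C\,\ell N^3|\mathcal X|^{5/4}|\mathcal A|^{1/4}\sqrt{\frac{\Psi}{1-\alpha}}\;T^{3/4}\,\log^k\!\Big(\frac{|\mathcal X||\mathcal A|NT}{\delta}\Big).$$ -/

import Mathlib

open MeasureTheory ProbabilityTheory Finset

noncomputable section

/-!
Conventions.  `X`, `A` are the finite state and action spaces, `N` is the horizon.
The time steps inside an episode are `n = 0, …, N`, modelled by `Fin (N + 1)`.
For an index `i : Fin N`, the step `n - 1 = i` is `i.castSucc` and the step `n = i + 1` is `i.succ`;
`p i` is the transition kernel and `π i` the decision rule used on entering the step `i + 1`.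
The episodes `1, …, T` are numbered `0, …, T - 1`.
-/

namespace PeriodicMDP

variable {X A : Type*} [Fintype X] [Fintype A] {N : ℕ}

/-- The `L¹` norm of a vector indexed by a finite set. -/
def l1 {S : Type*} [Fintype S] (v : S → ℝ) : ℝ := ∑ y, |v y|

/-- `p i y x'` is the probability of moving to the state `x'` at step `i + 1`
from the state-action pair `y` at step `i`. -/
def IsKernel (p : Fin N → X × A → X → ℝ) : Prop := ∀ i y, p i y ∈ stdSimplex ℝ X

/-- `π i x a` is the probability of choosing `a` in the state `x` at step `i + 1`. -/
def IsPolicy (π : Fin N → X → A → ℝ) : Prop := ∀ i x, π i x ∈ stdSimplex ℝ A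

/-- The sequence of state-action distributions induced by the policy `π` in the MDP with kernel `p`
and initial state-action distribution `ν`. -/
def occ (p : Fin N → X × A → X → ℝ) (π : Fin N → X → A → ℝ) (ν : X × A → ℝ) :
    Fin (N + 1) → X × A → ℝ :=
  fun n => Fin.induction (motive := fun _ => X × A → ℝ) ν
    (fun i μ z => ∑ y, μ y * p i y z.1 * π i z.1 z.2) n

/-- `ν P_π`: the state-action distribution at the last step `N` when starting from `ν`. -/
def terminal (p : Fin N → X × A → X → ℝ) (π : Fin N → X → A → ℝ) (ν : X × A → ℝ) : X × A → ℝ :=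
  occ p π ν (Fin.last N)

/-- `π` is a periodic policy for the initial distribution `ρ`. -/
def IsPeriodic (p : Fin N → X × A → X → ℝ) (ρ : X × A → ℝ) (π : Fin N → X → A → ℝ) : Prop :=
  IsPolicy π ∧ terminal p π ρ = ρ

/-- Contraction assumption: every periodic policy contracts the `L¹` distance between initial
distributions by the factor `α`. -/
def Contracts (p : Fin N → X × A → X → ℝ) (ρ : X × A → ℝ) (α : ℝ) : Prop :=
  ∀ π, IsPeriodic p ρ π → ∀ ν ∈ stdSimplex ℝ (X × A), ∀ ν' ∈ stdSimplex ℝ (X × A),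
    l1 (terminal p π ν - terminal p π ν') ≤ α * l1 (ν - ν')

/-- Probability of the trajectory `τ` of an agent that starts from a pair drawn from `ν`
and follows the policy `π` in the MDP with kernel `p`. -/
def pathProb (p : Fin N → X × A → X → ℝ) (π : Fin N → X → A → ℝ) (ν : X × A → ℝ)
    (τ : Fin (N + 1) → X × A) : ℝ :=
  ν (τ 0) * ∏ i : Fin N, p i (τ i.castSucc) (τ i.succ).1 * π i (τ i.succ).1 (τ i.succ).2

/-- `M_ρ^p`: the sequences of state-action distributions starting at `ρ` and satisfying the
dynamics `p`. -/
def flowSet (p : Fin N → X × A → X → ℝ) (ρ : X × A → ℝ) : Set (Fin (N + 1) → X × A → ℝ) :=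
  {μ | (∀ n, μ n ∈ stdSimplex ℝ (X × A)) ∧ μ 0 = ρ ∧
    ∀ (i : Fin N) (x : X), ∑ a, μ i.succ (x, a) = ∑ y, μ i.castSucc y * p i y x}

/-- The initial distribution of each episode: there is no reset, so the initial distribution of an
episode is the final one of the previous episode. -/
def initDist (p : Fin N → X × A → X → ℝ) (ρ : X × A → ℝ) (pol : ℕ → Fin N → X → A → ℝ) :
    ℕ → X × A → ℝ
  | 0 => ρ
  | t + 1 => terminal p (pol t) (initDist p ρ pol t)

open Classical in
/-- Number of visits of the pair `y` at step `n` in the trajectories observed before episode `t`. -/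
def visits (h : ℕ → Fin (N + 1) → X × A) (t : ℕ) (n : Fin (N + 1)) (y : X × A) : ℕ :=
  #{s ∈ range t | h s n = y}

open Classical in
/-- Number of transitions from the pair `y` at step `i` to the state `x'` at step `i + 1` in the
trajectories observed before episode `t`. -/
def transitions (h : ℕ → Fin (N + 1) → X × A) (t : ℕ) (i : Fin N) (y : X × A) (x' : X) : ℕ :=
  #{s ∈ range t | h s i.castSucc = y ∧ (h s i.succ).1 = x'}

/-- The empirical kernel used in episode `t`; it keeps its initial value, the uniform distribution,
at the pairs that have not been visited yet. -/
def empKernel (h : ℕ → Fin (N + 1) → X × A) (t : ℕ) : Fin N → X × A → X → ℝ :=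
  fun i y x' =>
    if visits h t i.castSucc y = 0 then 1 / (Fintype.card X : ℝ)
    else (transitions h t i y x' : ℝ) / max 1 (visits h t i.castSucc y : ℝ)

variable (X A N) in
/-- The constant `C_δ` of the bonuses. -/
def bonusConst (T : ℕ) (δ : ℝ) : ℝ :=
  √(2 * (Fintype.card X : ℝ) *
    Real.log ((Fintype.card X : ℝ) * (Fintype.card A : ℝ) * (N : ℝ) * (T : ℝ) / δ))

/-- The bonus `b_t` of the constraint. -/
def bonus (T : ℕ) (δ : ℝ) (h : ℕ → Fin (N + 1) → X × A) (t : ℕ) : Fin (N + 1) → X × A → ℝ :=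
  fun n y => bonusConst X A N T δ / √(max 1 (visits h t n y : ℝ))

/-- The bonus `b̄_t` subtracted from the gradient of the loss. -/
def lossBonus (T : ℕ) (δ ℓ : ℝ) (h : ℕ → Fin (N + 1) → X × A) (t : ℕ) :
    Fin (N + 1) → X × A → ℝ :=
  fun n y => ℓ * ((N : ℝ) - (n : ℕ)) * bonusConst X A N T δ / √(max 1 (visits h t n y : ℝ))

/-- The vector `ℓ_t - b̄_t`, at the steps `1, …, N`; `g i` is the gradient of the loss of
step `i + 1`. -/
def mdVec (T : ℕ) (δ ℓ : ℝ) (h : ℕ → Fin (N + 1) → X × A) (g : Fin N → X × A → ℝ) (t : ℕ) :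
    Fin N → X × A → ℝ :=
  fun i y => g i y - lossBonus T δ ℓ h t i.succ y

/-- The pairing over the steps `1, …, N`. -/
def pairing (z : Fin N → X × A → ℝ) (μ : Fin (N + 1) → X × A → ℝ) : ℝ :=
  ∑ i : Fin N, ∑ y, z i y * μ i.succ y

/-- The constraint set of episode `t`: the flow set of the empirical kernel and of the current
initial distribution `ρt`, with the relaxed constraint on the final distribution.
The bonus is paired over the steps `0, …, N - 1`. -/
def constraintSet (T : ℕ) (δ α : ℝ) (ρ ρt : X × A → ℝ) (h : ℕ → Fin (N + 1) → X × A) (t : ℕ) :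
    Set (Fin (N + 1) → X × A → ℝ) :=
  {μ | μ ∈ flowSet (empKernel h t) ρt ∧
    l1 (μ (Fin.last N) - ρ) ≤
      ∑ i : Fin N, ∑ y, μ i.castSucc y * bonus T δ h t i.castSucc y + α * l1 (ρt - ρ)}

/-- The two mirror-descent divergences. -/
inductive Div
  | kl
  | gamma

/-- The divergence `D_ψ(μ, μ')`, where `μ'` is the sequence induced by the policy `π'`.
For `kl` it is induced by `ψ(μ) = ∑ μ_n(x,a) log μ_n(x,a)`, over all steps; for `gamma` it is induced
by `ψ(μ) = ∑_{n ≥ 1} μ_n(x,a) log (μ_n(x,a) / ∑_b μ_n(x,b)) + ∑ μ_0(x,a) log μ_0(x,a)`.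
The terms of the step `0` are constant on the constraint sets, where `μ_0` is prescribed. -/
def Div.val : Div → (μ μ' : Fin (N + 1) → X × A → ℝ) → (π' : Fin N → X → A → ℝ) → ℝ
  | .kl, μ, μ', _ => ∑ n, ∑ y, μ n y * Real.log (μ n y / μ' n y)
  | .gamma, μ, μ', π' =>
      ∑ i : Fin N, ∑ x, ∑ a, μ i.succ (x, a) *
          Real.log ((μ i.succ (x, a) / ∑ b, μ i.succ (x, b)) / π' i x a)
        + ∑ y, μ 0 y * Real.log (μ 0 y / μ' 0 y)

/-- `ψ` is differentiable at the sequence `μ` induced by the policy `π`, in the variables of the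
steps `1, …, N`. -/
def Div.Regular : Div → (μ : Fin (N + 1) → X × A → ℝ) → (π : Fin N → X → A → ℝ) → Prop
  | .kl, μ, _ => ∀ (i : Fin N) (y : X × A), 0 < μ i.succ y
  | .gamma, _, π => ∀ (i : Fin N) (x : X) (a : A), 0 < π i x a

/-- The gradient of `ψ` at the sequence `μ` induced by the policy `π`, at the steps `1, …, N`. -/
def Div.grad : Div → (μ : Fin (N + 1) → X × A → ℝ) → (π : Fin N → X → A → ℝ) → Fin N → X × A → ℝ
  | .kl, μ, _ => fun i y => Real.log (μ i.succ y) + 1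
  | .gamma, _, π => fun i y => Real.log (π i y.1 y.2)

/-- The norm `‖v‖_{1,∞} = ∑_n ‖v_n‖_∞`. -/
def norm1inf (v : Fin N → X × A → ℝ) : ℝ := ∑ i, ⨆ y, |v i y|

/-- `μ_t`: the state-action distributions induced in the estimated MDP by the policy played in
episode `t`, from the initial distribution of the episode. -/
def iterate (p : Fin N → X × A → X → ℝ) (ρ : X × A → ℝ) (h : ℕ → Fin (N + 1) → X × A)
    (pol : ℕ → Fin N → X → A → ℝ) (t : ℕ) : Fin (N + 1) → X × A → ℝ :=
  occ (empKernel h t) (pol t) (initDist p ρ pol t)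

/-- `g` is a subgradient of `f` at `u` (the gradient, if `f` is convex and differentiable at `u`). -/
def IsSubgradient (f : (X × A → ℝ) → ℝ) (u g : X × A → ℝ) : Prop :=
  ∀ v, f u + ∑ y, g y * (v y - u y) ≤ f v

/-- The losses of all episodes and steps are convex and `ℓ`-Lipschitz for the `L¹` norm. -/
def IsLoss (ℓ : ℝ) (T : ℕ) (f : ℕ → Fin N → (X × A → ℝ) → ℝ) : Prop :=
  ∀ t < T, ∀ i, ConvexOn ℝ Set.univ (f t i) ∧ ∀ u v, |f t i u - f t i v| ≤ ℓ * l1 (u - v)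

/-- The mirror-descent rule along one realization: in each episode, the next iterate solves the
constrained problem, whenever the divergence to the current iterate is defined and the constraint
set is non-empty. -/
def FollowsRule (D : Div) (T : ℕ) (δ ℓ α η : ℝ) (p : Fin N → X × A → X → ℝ) (ρ : X × A → ℝ)
    (h : ℕ → Fin (N + 1) → X × A) (pol : ℕ → Fin N → X → A → ℝ)
    (g : ℕ → Fin N → X × A → ℝ) : Prop :=
  ∀ t, t + 1 < T → D.Regular (iterate p ρ h pol t) (pol t) →
    (constraintSet T δ α ρ (initDist p ρ pol (t + 1)) h (t + 1)).Nonempty →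
    iterate p ρ h pol (t + 1) ∈ constraintSet T δ α ρ (initDist p ρ pol (t + 1)) h (t + 1) ∧
    IsMinOn (fun μ => η * pairing (mdVec T δ ℓ h (g t) t) μ + D.val μ (iterate p ρ h pol t) (pol t))
      (constraintSet T δ α ρ (initDist p ρ pol (t + 1)) h (t + 1)) (iterate p ρ h pol (t + 1))

/-- The mirror-descent regret term `∑_t ⟨ℓ_t - b̄_t, μ_t - μ̂_t^{π, ρ_t}⟩` against the policy `π`. -/
def regretMD (T : ℕ) (δ ℓ : ℝ) (p : Fin N → X × A → X → ℝ) (ρ : X × A → ℝ)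
    (h : ℕ → Fin (N + 1) → X × A) (pol : ℕ → Fin N → X → A → ℝ)
    (g : ℕ → Fin N → X × A → ℝ) (π : Fin N → X → A → ℝ) : ℝ :=
  ∑ t ∈ range T, pairing (mdVec T δ ℓ h (g t) t)
    (iterate p ρ h pol t - occ (empKernel h t) π (initDist p ρ pol t))

/-- The observation model.  `ℱ t` is the information available before episode `t`; the policy of
episode `t` is `ℱ t`-measurable, and, given `ℱ t`, the trajectory observed in episode `t` is that of
an agent that starts from a pair drawn from the current initial distribution and plays the
current policy in the true MDP. -/
structure IsObservation {Ω : Type*} [mΩ : MeasurableSpace Ω] (P : Measure Ω) (ℱ : Filtration ℕ mΩ)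
    (T : ℕ) (p : Fin N → X × A → X → ℝ) (ρ : X × A → ℝ)
    (traj : ℕ → Ω → Fin (N + 1) → X × A) (pol : ℕ → Ω → Fin N → X → A → ℝ) : Prop where
  isPolicy : ∀ t < T, ∀ ω, IsPolicy (pol t ω)
  measurable_pol : ∀ t < T, Measurable[ℱ t] (pol t)
  measurable_traj : ∀ t < T, ∀ τ, MeasurableSet[ℱ (t + 1)] {ω | traj t ω = τ}
  condLaw : ∀ t < T, ∀ τ,
    P[Set.indicator {ω | traj t ω = τ} (fun _ => (1 : ℝ)) | ℱ t] =ᵐ[P]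
      fun ω => pathProb p (pol t ω) (initDist p ρ (fun s => pol s ω) t) τ

end PeriodicMDP

end

set_option linter.unusedSectionVars false

namespace PeriodicMDP

/-! ### Finite-dimensional estimates: `L¹` norms and induced distributions. -/

section Deterministic

variable {X A : Type*} [Fintype X] [Fintype A] {N : ℕ}

/-! The bound is the regret of mirror descent with moving constraint sets and moving comparators;
everything reduces to the total drift `V` of the problem between consecutive episodes.

Write `c_t` for the distributions induced by the fixed periodic policy in the model of episode `t`,
`G_t` for the gradient of `ψ` at `μ_t`, and `z_t` for the linear loss. On the event where each
empirical kernel is within its bonus of `p`, contraction makes `c_t` feasible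
(`occ_mem_constraintSet`), so the algorithm does solve its constrained problem. Optimality of
`μ_{t+1}` tested against `c_{t+1}` gives `0 ≤ η⟨z_t, c_{t+1} - μ_{t+1}⟩ + ⟨G_{t+1} - G_t, c_{t+1} -
μ_{t+1}⟩`. The quantity `K = ⟨G_{t+1} - G_t, μ_{t+1}⟩` is a relative entropy, so a Pinsker
inequality bounds `‖μ_{t+1} - μ_t‖₁` by `2√K` plus a drift, and completing the square absorbs `√K`
into `-K` (`pairing_step_le`). Summation by parts turns the remaining `⟨G_{t+1} - G_t, c_{t+1}⟩`
into at most `Ψ (V + 2)`, since the gradients are bounded by `Ψ` and the comparators move by at most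
the drift (`regretMD_le`).

The drift has two sources. Empirical kernels move by the inverse visit count at the visited pair,
which sums to order `√(|X||A|T)` per step. The initial distributions move by at most `r_t +
r_{t+1}`, with `r_t = ‖ρ_t - ρ‖₁`. The relaxed final constraint, transferred to the true model,
yields `r_{t+1} ≤ α r_t + m_t`, where `m_t` is a multiple of the expected bonus of the episode
(`l1_terminal_sub_le`), so `∑ r_t` costs a factor `1 / (1 - α)` (`sum_contraction_le`). A second
event compares the expected bonuses with the observed ones, which again sum to order `√(|X||A|T)`.
Hence `V` is of order `N² C_δ² √(|X||A|T) log / (1 - α)`, and balancing `Ψ V / η` against `T η (N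
κ)²`, with `κ = ℓ N C_δ` the sup bound of `z_t`, gives the rate.

Both events come from one supermartingale principle (`measureReal_prod_ge_le`). They fail with
probability at most `2δ` and `δ`, hence `1 - 3δ`. Terms linear in `V` fit into the rate only if `Ψ`
is bounded below; with two actions this follows from the hypothesis on the gradient
(`le_norm1inf_grad`), and with one action all policies coincide. -/

lemma l1_nonneg {S : Type*} [Fintype S] (v : S → ℝ) : 0 ≤ l1 v :=
  sum_nonneg fun _ _ => abs_nonneg _

lemma l1_add_le {S : Type*} [Fintype S] (u v : S → ℝ) : l1 (u + v) ≤ l1 u + l1 v := by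
  simp only [l1, ← sum_add_distrib]
  exact sum_le_sum fun y _ => abs_add_le _ _

lemma l1_sub_comm {S : Type*} [Fintype S] (u v : S → ℝ) : l1 (u - v) = l1 (v - u) := by
  simp only [l1, Pi.sub_apply, abs_sub_comm]

lemma l1_sub_le {S : Type*} [Fintype S] (u v w : S → ℝ) :
    l1 (u - w) ≤ l1 (u - v) + l1 (v - w) := by
  have := l1_add_le (u - v) (v - w)
  rwa [sub_add_sub_cancel] at this

lemma l1_of_mem {S : Type*} [Fintype S] {u : S → ℝ} (hu : u ∈ stdSimplex ℝ S) : l1 u = 1 := by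
  rw [← hu.2]; exact sum_congr rfl fun y _ => abs_of_nonneg (hu.1 y)

lemma l1_sub_le_two {S : Type*} [Fintype S] {u v : S → ℝ} (hu : u ∈ stdSimplex ℝ S)
    (hv : v ∈ stdSimplex ℝ S) : l1 (u - v) ≤ 2 := by
  have h := l1_sub_le u 0 v
  rw [sub_zero, l1_sub_comm 0 v, sub_zero, l1_of_mem hu, l1_of_mem hv] at h
  linarith

lemma abs_sum_mul_le {S : Type*} [Fintype S] (z u : S → ℝ) {c : ℝ} (hz : ∀ y, |z y| ≤ c) :
    |∑ y, z y * u y| ≤ c * l1 u := by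
  refine (abs_sum_le_sum_abs _ _).trans ?_
  rw [l1, mul_sum]
  refine sum_le_sum fun y _ => ?_
  rw [abs_mul]
  exact mul_le_mul_of_nonneg_right (hz y) (abs_nonneg _)

/-- Increments of a finite sequence bound all its values. -/
lemma le_add_sum_of_succ_le {N : ℕ} (a : Fin (N + 1) → ℝ) (c : Fin N → ℝ) (hc : ∀ i, 0 ≤ c i)
    (h : ∀ i : Fin N, a i.succ ≤ a i.castSucc + c i) (n : Fin (N + 1)) : a n ≤ a 0 + ∑ i, c i := by
  induction N with
  | zero => simp [Fin.fin_one_eq_zero n]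
  | succ N ih =>
    refine Fin.cases ?_ (fun j => ?_) n
    · have := sum_nonneg fun i (_ : i ∈ univ) => hc i
      linarith
    · have h1 := ih (fun i => a i.succ) (fun i => c i.succ) (fun i => hc _)
        (fun i => by simpa using h i.succ) j
      have h2 := h 0
      rw [Fin.sum_univ_succ]
      simp only [Fin.castSucc_zero] at h1 h2 ⊢
      linarith

lemma occ_zero (p : Fin N → X × A → X → ℝ) (π : Fin N → X → A → ℝ) (ν : X × A → ℝ) :
    occ p π ν 0 = ν := rfl

lemma occ_succ (p : Fin N → X × A → X → ℝ) (π : Fin N → X → A → ℝ) (ν : X × A → ℝ) (i : Fin N)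
    (z : X × A) :
    occ p π ν i.succ z = (∑ y, occ p π ν i.castSucc y * p i y z.1) * π i z.1 z.2 := by
  rw [sum_mul]; rfl

lemma sum_occ_succ {p : Fin N → X × A → X → ℝ} {π : Fin N → X → A → ℝ} (hπ : IsPolicy π)
    (ν : X × A → ℝ) (i : Fin N) (x : X) :
    ∑ a, occ p π ν i.succ (x, a) = ∑ y, occ p π ν i.castSucc y * p i y x := by
  simp only [occ_succ, ← mul_sum, (hπ i x).2, mul_one]

lemma occ_mem {p : Fin N → X × A → X → ℝ} {π : Fin N → X → A → ℝ} {ν : X × A → ℝ}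
    (hp : IsKernel p) (hπ : IsPolicy π) (hν : ν ∈ stdSimplex ℝ (X × A)) (n : Fin (N + 1)) :
    occ p π ν n ∈ stdSimplex ℝ (X × A) := by
  induction n using Fin.induction with
  | zero => exact hν
  | succ i ih =>
    constructor
    · intro z
      rw [occ_succ]
      exact mul_nonneg (sum_nonneg fun y _ => mul_nonneg (ih.1 y) ((hp i y).1 _)) ((hπ i _).1 _)
    · rw [Fintype.sum_prod_type]
      simp only [sum_occ_succ hπ]
      rw [sum_comm]
      simp only [← mul_sum, (hp i _).2, mul_one]
      exact ih.2

lemma occ_mem_flowSet {p : Fin N → X × A → X → ℝ} {π : Fin N → X → A → ℝ} {ν : X × A → ℝ}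
    (hp : IsKernel p) (hπ : IsPolicy π) (hν : ν ∈ stdSimplex ℝ (X × A)) :
    occ p π ν ∈ flowSet p ν :=
  ⟨occ_mem hp hπ hν, rfl, fun i x => sum_occ_succ hπ ν i x⟩

lemma initDist_mem {p : Fin N → X × A → X → ℝ} {ρ : X × A → ℝ} {pol : ℕ → Fin N → X → A → ℝ}
    {T : ℕ} (hp : IsKernel p) (hρ : ρ ∈ stdSimplex ℝ (X × A)) (hpol : ∀ t < T, IsPolicy (pol t))
    {t : ℕ} (ht : t ≤ T) : initDist p ρ pol t ∈ stdSimplex ℝ (X × A) := by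
  induction t with
  | zero => exact hρ
  | succ t ih => exact occ_mem hp (hpol t ht) (ih (by omega)) (Fin.last N)

/-- Perturbation bound for the induced distributions, in the initial distribution and the kernel. -/
lemma l1_occ_sub_le {p p' : Fin N → X × A → X → ℝ} {π : Fin N → X → A → ℝ} {ν ν' : X × A → ℝ}
    (hp : IsKernel p) (hp' : IsKernel p') (hπ : IsPolicy π) (hν : ν ∈ stdSimplex ℝ (X × A))
    (n : Fin (N + 1)) :
    l1 (occ p π ν n - occ p' π ν' n) ≤
      l1 (ν - ν') + ∑ i : Fin N, ∑ y, occ p π ν i.castSucc y * l1 (p i y - p' i y) := by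
  refine le_add_sum_of_succ_le (fun n => l1 (occ p π ν n - occ p' π ν' n))
    (fun i => ∑ y, occ p π ν i.castSucc y * l1 (p i y - p' i y)) (fun i => ?_) (fun i => ?_) n
  · exact sum_nonneg fun y _ => mul_nonneg ((occ_mem hp hπ hν _).1 y) (l1_nonneg _)
  · have hμ := occ_mem hp hπ hν i.castSucc
    set μ := occ p π ν i.castSucc
    set μ' := occ p' π ν' i.castSucc
    have h1 : l1 (occ p π ν i.succ - occ p' π ν' i.succ) =
        ∑ x, |∑ y, (μ y * p i y x - μ' y * p' i y x)| := by
      rw [l1, Fintype.sum_prod_type]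
      refine sum_congr rfl fun x _ => ?_
      have : ∀ a, |(occ p π ν i.succ - occ p' π ν' i.succ) (x, a)| =
          |∑ y, (μ y * p i y x - μ' y * p' i y x)| * π i x a := by
        intro a
        rw [Pi.sub_apply, occ_succ, occ_succ, ← sub_mul, abs_mul, abs_of_nonneg ((hπ i x).1 a),
          sum_sub_distrib]
      simp only [this, ← mul_sum, (hπ i x).2, mul_one]
    have h2 : ∀ x, |∑ y, (μ y * p i y x - μ' y * p' i y x)| ≤
        ∑ y, (μ y * |p i y x - p' i y x| + |μ y - μ' y| * p' i y x) := by
      intro x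
      refine (abs_sum_le_sum_abs _ _).trans (sum_le_sum fun y _ => ?_)
      -- This splitting weights the kernel error by the law of the first model. Feasibility puts the
      -- estimated model first, to match the constraint; the bound on the true final law puts the
      -- true model first, to match the concentration event.
      have : μ y * p i y x - μ' y * p' i y x =
          μ y * (p i y x - p' i y x) + (μ y - μ' y) * p' i y x := by ring
      rw [this]
      refine (abs_add_le _ _).trans ?_
      rw [abs_mul, abs_mul, abs_of_nonneg (hμ.1 y), abs_of_nonneg ((hp' i y).1 x)]
    show l1 (occ p π ν i.succ - occ p' π ν' i.succ) ≤ l1 (μ - μ') + _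
    rw [h1]
    refine (sum_le_sum fun x _ => h2 x).trans (le_of_eq ?_)
    rw [sum_comm]
    simp only [sum_add_distrib, ← mul_sum, (hp' i _).2, mul_one]
    rw [add_comm]; rfl

/-! ### Visit counts and empirical kernels. -/

lemma visits_succ (h : ℕ → Fin (N + 1) → X × A) (t : ℕ) (n : Fin (N + 1)) (y : X × A)
    [Decidable (h t n = y)] :
    visits h (t + 1) n y = visits h t n y + if h t n = y then 1 else 0 := by
  classical
  simp only [visits, range_add_one, filter_insert]
  split_ifs <;> simp_all

lemma transitions_succ (h : ℕ → Fin (N + 1) → X × A) (t : ℕ) (i : Fin N) (y : X × A) (x : X)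
    [Decidable (h t i.castSucc = y ∧ (h t i.succ).1 = x)] :
    transitions h (t + 1) i y x =
      transitions h t i y x + if h t i.castSucc = y ∧ (h t i.succ).1 = x then 1 else 0 := by
  classical
  simp only [transitions, range_add_one, filter_insert]
  split_ifs <;> simp_all

lemma sum_transitions (h : ℕ → Fin (N + 1) → X × A) (t : ℕ) (i : Fin N) (y : X × A) :
    ∑ x, transitions h t i y x = visits h t i.castSucc y := by
  classical
  induction t with
  | zero => simp [transitions, visits]
  | succ t ih =>
    simp only [visits_succ, transitions_succ, sum_add_distrib, ih]
    by_cases hy : h t i.castSucc = y <;> simp [hy]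

lemma sum_visits (h : ℕ → Fin (N + 1) → X × A) (t : ℕ) (n : Fin (N + 1)) :
    ∑ y, visits h t n y = t := by
  classical
  induction t with
  | zero => simp [visits]
  | succ t ih => simp [visits_succ, sum_add_distrib, ih]

lemma visits_le (h : ℕ → Fin (N + 1) → X × A) (t : ℕ) (n : Fin (N + 1)) (y : X × A) :
    visits h t n y ≤ t := by
  have := single_le_sum (f := fun y => visits h t n y) (fun _ _ => Nat.zero_le _) (mem_univ y)
  rwa [sum_visits] at this

lemma empKernel_of_pos {h : ℕ → Fin (N + 1) → X × A} {t : ℕ} {i : Fin N} {y : X × A}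
    (hv : visits h t i.castSucc y ≠ 0) (x : X) :
    empKernel h t i y x = (transitions h t i y x : ℝ) / visits h t i.castSucc y := by
  have : (1 : ℝ) ≤ visits h t i.castSucc y := by exact_mod_cast Nat.one_le_iff_ne_zero.2 hv
  simp [empKernel, hv, max_eq_right this]

lemma isKernel_empKernel [Nonempty X] (h : ℕ → Fin (N + 1) → X × A) (t : ℕ) :
    IsKernel (empKernel h t) := by
  intro i y
  by_cases hv : visits h t i.castSucc y = 0
  · have : empKernel h t i y = fun _ => 1 / (Fintype.card X : ℝ) := by
      ext x; simp [empKernel, hv]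
    rw [this]
    exact ⟨fun _ => by positivity, by simp⟩
  · constructor
    · intro x; rw [empKernel_of_pos hv]; positivity
    · simp only [empKernel_of_pos hv, ← sum_div]
      rw [← Nat.cast_sum, sum_transitions, div_self]
      exact_mod_cast hv

/-- Makes the inverse roots telescope. For `k ≥ 1` the increment is `1 / (√(k+1) + √k)`, and `√(k+1)
≤ 2√k` gives the constant 3. -/
lemma one_div_sqrt_le (k : ℕ) : 1 / √(max 1 (k : ℝ)) ≤ 3 * (√((k + 1 : ℕ) : ℝ) - √(k : ℝ)) := by
  rcases Nat.eq_zero_or_pos k with rfl | hk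
  · norm_num
  have hk' : (1 : ℝ) ≤ k := by exact_mod_cast hk
  rw [max_eq_right hk']
  have ha : 0 < √(k : ℝ) := Real.sqrt_pos.2 (by linarith)
  have ha2 : √(k : ℝ) ^ 2 = k := Real.sq_sqrt (by linarith)
  have hb2 : √((k + 1 : ℕ) : ℝ) ^ 2 = k + 1 := by
    rw [Real.sq_sqrt (by positivity)]; push_cast; ring
  have hb : 0 ≤ √((k + 1 : ℕ) : ℝ) := Real.sqrt_nonneg _
  have hba : √((k + 1 : ℕ) : ℝ) ≤ 2 * √(k : ℝ) := by
    apply abs_le_of_sq_le_sq' _ (by positivity) |>.2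
    rw [mul_pow, ha2, hb2]; linarith
  rw [div_le_iff₀ ha]
  have : (√((k + 1 : ℕ) : ℝ) - √(k : ℝ)) * (√((k + 1 : ℕ) : ℝ) + √(k : ℝ)) = 1 := by
    linear_combination hb2 - ha2
  have h0 : 0 ≤ √((k + 1 : ℕ) : ℝ) - √(k : ℝ) := by
    by_contra hneg
    push Not at hneg
    have := mul_pos_of_neg_of_neg hneg (show -(√((k + 1 : ℕ) : ℝ) + √(k : ℝ)) < 0 by linarith)
    linarith
  nlinarith

/-- Sum of the inverse square roots of the visit counts along a trajectory. -/
lemma sum_inv_sqrt_visits_le (h : ℕ → Fin (N + 1) → X × A) (T : ℕ) (n : Fin (N + 1)) :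
    ∑ t ∈ range T, 1 / √(max 1 (visits h t n (h t n) : ℝ)) ≤
      3 * √((Fintype.card X : ℝ) * Fintype.card A * T) := by
  classical
  -- The potential `∑ y, √(visits)` changes only at the visited pair, by an increment that pays for
  -- the new term.
  have h1 : ∑ t ∈ range T, 1 / √(max 1 (visits h t n (h t n) : ℝ)) ≤
      3 * ∑ y, √(visits h T n y : ℝ) := by
    induction T with
    | zero => simp [visits]
    | succ t ih =>
      rw [sum_range_succ]
      have : ∑ y, √(visits h (t + 1) n y : ℝ) = ∑ y, √(visits h t n y : ℝ) +
          (√((visits h t n (h t n) + 1 : ℕ) : ℝ) - √(visits h t n (h t n) : ℝ)) := by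
        rw [← sub_eq_iff_eq_add', ← sum_sub_distrib, sum_eq_single (h t n)]
        · simp [visits_succ]
        · intro y _ hy
          simp [visits_succ, Ne.symm hy]
        · simp
      rw [this]
      have := one_div_sqrt_le (visits h t n (h t n))
      linarith
  refine h1.trans (mul_le_mul_of_nonneg_left ?_ (by norm_num))
  apply Real.le_sqrt_of_sq_le
  -- Cauchy–Schwarz over the `|X||A|` pairs, whose counts add up to `T`.
  have h2 := sq_sum_le_card_mul_sum_sq (s := (univ : Finset (X × A)))
    (f := fun y => √(visits h T n y : ℝ))
  refine h2.trans (le_of_eq ?_)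
  simp only [Real.sq_sqrt (Nat.cast_nonneg _)]
  rw [← Nat.cast_sum, sum_visits]
  simp [Fintype.card_prod]

/-- The empirical kernel changes only at the visited pairs, and slowly. -/
lemma l1_empKernel_succ_sub_le [Nonempty X] (h : ℕ → Fin (N + 1) → X × A) (t : ℕ) (i : Fin N)
    (y : X × A) :
    l1 (empKernel h (t + 1) i y - empKernel h t i y) ≤
      2 * (1 / √(max 1 (visits h t i.castSucc (h t i.castSucc) : ℝ))) := by
  classical
  by_cases hy : h t i.castSucc = y
  · rw [hy]
    -- At a first visit the uniform default is discarded rather than averaged, but then the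
    -- right-hand side is the trivial bound 2.
    by_cases hv : visits h t i.castSucc y = 0
    · have := l1_sub_le_two (isKernel_empKernel h (t + 1) i y) (isKernel_empKernel h t i y)
      simpa [hv] using this
    · set v := visits h t i.castSucc y with hvdef
      have hv1 : (1 : ℝ) ≤ v := by exact_mod_cast Nat.one_le_iff_ne_zero.2 hv
      have hs : visits h (t + 1) i.castSucc y = v + 1 := by rw [visits_succ]; simp [hy]; rfl
      set e : X → ℝ := fun x => if (h t i.succ).1 = x then 1 else 0
      have he : e ∈ stdSimplex ℝ X :=
        ⟨fun x => by simp only [e]; split_ifs <;> norm_num, by simp [e]⟩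
      -- The new frequencies are an average giving weight `1 / (v + 1)` to the point mass at the
      -- observed state.
      have heq : empKernel h (t + 1) i y - empKernel h t i y =
          (1 / ((v : ℝ) + 1)) • (e - empKernel h t i y) := by
        ext x
        simp only [Pi.sub_apply, Pi.smul_apply, smul_eq_mul]
        rw [empKernel_of_pos (by omega), empKernel_of_pos hv, hs, transitions_succ, ← hvdef]
        have : (v : ℝ) ≠ 0 := by positivity
        simp only [hy, true_and, e]
        push_cast
        field_simp
        ring
      have hl : l1 (empKernel h (t + 1) i y - empKernel h t i y) =
          1 / ((v : ℝ) + 1) * l1 (e - empKernel h t i y) := by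
        rw [heq, l1, l1, mul_sum]
        refine sum_congr rfl fun x _ => ?_
        rw [Pi.smul_apply, smul_eq_mul, abs_mul, abs_of_nonneg (by positivity)]
      rw [hl, max_eq_right hv1, mul_comm]
      refine mul_le_mul (l1_sub_le_two he (isKernel_empKernel h t i y)) ?_ (by positivity)
        (by norm_num)
      refine one_div_le_one_div_of_le (Real.sqrt_pos.2 (by linarith)) ?_
      refine (Real.sqrt_le_left (by linarith)).2 ?_
      nlinarith
  · have : empKernel h (t + 1) i y = empKernel h t i y := by
      ext x
      simp [empKernel, visits_succ, transitions_succ, hy]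
    rw [this, sub_self]
    have : l1 (0 : X → ℝ) = 0 := by simp [l1]
    rw [this]; positivity

lemma pairing_sub (z : Fin N → X × A → ℝ) (μ μ' : Fin (N + 1) → X × A → ℝ) :
    pairing z (μ - μ') = pairing z μ - pairing z μ' := by
  simp [pairing, mul_sub, sum_sub_distrib]

lemma pairing_sub_left (z z' : Fin N → X × A → ℝ) (μ : Fin (N + 1) → X × A → ℝ) :
    pairing (z - z') μ = pairing z μ - pairing z' μ := by
  simp [pairing, sub_mul, sum_sub_distrib]

lemma abs_pairing_le_norm1inf (z : Fin N → X × A → ℝ) (μ : Fin (N + 1) → X × A → ℝ) {d : ℝ}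
    (hd : ∀ i : Fin N, l1 (μ i.succ) ≤ d) : |pairing z μ| ≤ norm1inf z * d := by
  refine (abs_sum_le_sum_abs _ _).trans ?_
  rw [norm1inf, sum_mul]
  refine sum_le_sum fun i _ => ?_
  have hb : BddAbove (Set.range fun y => |z i y|) := Set.finite_range _ |>.bddAbove
  refine (abs_sum_mul_le _ _ fun y => le_ciSup hb y).trans ?_
  exact mul_le_mul_of_nonneg_left (hd i) (Real.iSup_nonneg fun _ => abs_nonneg _)

lemma abs_pairing_le (z : Fin N → X × A → ℝ) (μ : Fin (N + 1) → X × A → ℝ) {c d : ℝ}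
    (hc : 0 ≤ c) (hz : ∀ i y, |z i y| ≤ c) (hd : ∀ i : Fin N, l1 (μ i.succ) ≤ d) :
    |pairing z μ| ≤ N * c * d := by
  refine (abs_sum_le_sum_abs _ _).trans ?_
  refine (sum_le_sum fun i _ => (abs_sum_mul_le _ _ (hz i)).trans
    (mul_le_mul_of_nonneg_left (hd i) hc)).trans (le_of_eq ?_)
  simp [mul_assoc]

end Deterministic

/-! ### Relative entropy: Pinsker, log-sum, and the chain rule along a trajectory. -/

section Divergence

/-- The relative entropy of two vectors indexed by a finite set. -/
noncomputable def relEnt {S : Type*} [Fintype S] (a b : S → ℝ) : ℝ :=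
  ∑ y, a y * (Real.log (a y) - Real.log (b y))

/-- A Pinsker-type inequality, obtained from the Hellinger distance. -/
lemma sq_l1_sub_le_relEnt {S : Type*} [Fintype S] {a b : S → ℝ} (ha : a ∈ stdSimplex ℝ S)
    (hb : b ∈ stdSimplex ℝ S) (hab : ∀ y, b y = 0 → a y = 0) :
    l1 (a - b) ^ 2 ≤ 4 * relEnt a b := by
  have ha2 : ∀ y, √(a y) ^ 2 = a y := fun y => Real.sq_sqrt (ha.1 y)
  have hb2 : ∀ y, √(b y) ^ 2 = b y := fun y => Real.sq_sqrt (hb.1 y)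
  set B := ∑ y, √(a y) * √(b y)
  -- `B` is the Hellinger affinity. From `log x ≤ x - 1` the entropy dominates `2 - 2B`, and
  -- Cauchy–Schwarz bounds the squared norm by `(2 - 2B)(2 + 2B)`; the factor 4 comes from `B ≤ 1`.
  have h1 : 2 - 2 * B ≤ relEnt a b := by
    have : ∑ y, 2 * (a y - √(a y) * √(b y)) ≤ relEnt a b := by
      refine sum_le_sum fun y _ => ?_
      rcases (ha.1 y).eq_or_lt with h0 | h0
      · simp [← h0]
      · have hb0 : 0 < b y := (hb.1 y).lt_of_ne fun h => h0.ne' (hab y h.symm)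
        have hsa := Real.sqrt_pos.2 h0
        have hsb := Real.sqrt_pos.2 hb0
        have hl := Real.log_le_sub_one_of_pos (div_pos hsb hsa)
        rw [Real.log_div hsb.ne' hsa.ne', Real.log_sqrt hb0.le, Real.log_sqrt h0.le] at hl
        have h3 : a y * (√(b y) / √(a y)) = √(a y) * √(b y) := by
          nth_rewrite 1 [← ha2 y]; field_simp
        have h4 := mul_le_mul_of_nonneg_left hl h0.le
        rw [mul_sub (a y) (√(b y) / √(a y)), h3] at h4
        linarith
    rwa [← mul_sum, sum_sub_distrib, ha.2, mul_sub, mul_one] at this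
  have hm : ∑ y, (√(a y) - √(b y)) ^ 2 = 2 - 2 * B := by
    have : ∀ y, (√(a y) - √(b y)) ^ 2 = a y + b y - 2 * (√(a y) * √(b y)) := fun y => by
      rw [sub_sq, ha2, hb2]; ring
    simp only [this, sum_sub_distrib, sum_add_distrib, ha.2, hb.2, ← mul_sum]
    norm_num [B]
  have hp : ∑ y, (√(a y) + √(b y)) ^ 2 = 2 + 2 * B := by
    have : ∀ y, (√(a y) + √(b y)) ^ 2 = a y + b y + 2 * (√(a y) * √(b y)) := fun y => by
      rw [add_sq, ha2, hb2]; ring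
    simp only [this, sum_add_distrib, ha.2, hb.2, ← mul_sum]
    norm_num [B]
  have h0 : 0 ≤ 2 - 2 * B := hm ▸ sum_nonneg fun _ _ => sq_nonneg _
  have hcs : l1 (a - b) ^ 2 ≤ (2 - 2 * B) * (2 + 2 * B) := by
    rw [← hm, ← hp]
    have := sum_mul_sq_le_sq_mul_sq univ (fun y => |√(a y) - √(b y)|) (fun y => √(a y) + √(b y))
    simp only [sq_abs] at this
    refine le_trans (le_of_eq ?_) this
    congr 1
    refine sum_congr rfl fun y _ => ?_
    rw [← abs_of_nonneg (show 0 ≤ √(a y) + √(b y) by positivity), ← abs_mul, Pi.sub_apply]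
    congr 1
    nlinarith [ha2 y, hb2 y]
  nlinarith

/-- The log-sum inequality. -/
lemma log_sum_le {S : Type*} [Fintype S] {a b : S → ℝ} (ha : ∀ y, 0 ≤ a y) (hb : ∀ y, 0 ≤ b y)
    (hab : ∀ y, b y = 0 → a y = 0) :
    (∑ y, a y) * (Real.log (∑ y, a y) - Real.log (∑ y, b y)) ≤ relEnt a b := by
  rcases (sum_nonneg fun y (_ : y ∈ univ) => ha y).eq_or_lt with h0 | h0
  · have : ∀ y, a y = 0 := fun y =>
      (sum_eq_zero_iff_of_nonneg fun y _ => ha y).1 h0.symm y (mem_univ y)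
    simp [relEnt, this]
  · have hB : 0 < ∑ y, b y := by
      obtain ⟨y, -, hy⟩ := exists_ne_zero_of_sum_ne_zero h0.ne'
      exact sum_pos' (fun y _ => hb y) ⟨y, mem_univ y, (hb y).lt_of_ne fun h => hy (hab y h.symm)⟩
    set U := ∑ y, a y with hU
    set V := ∑ y, b y with hV
    -- This is `log x ≤ x - 1` at `x = b y * U / (a y * V)`; the two correction terms cancel after
    -- summation over `y`.
    have : ∀ y, a y * (Real.log U - Real.log V) + a y - b y * (U / V) ≤
        a y * (Real.log (a y) - Real.log (b y)) := by
      intro y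
      rcases (ha y).eq_or_lt with hy | hy
      · have := mul_nonneg (hb y) (div_pos h0 hB).le
        simp only [← hy]; linarith
      · have hby : 0 < b y := (hb y).lt_of_ne fun h => hy.ne' (hab y h.symm)
        have hl := Real.log_le_sub_one_of_pos (div_pos (mul_pos hby h0) (mul_pos hy hB))
        rw [Real.log_div (by positivity) (by positivity), Real.log_mul hby.ne' h0.ne',
          Real.log_mul hy.ne' hB.ne'] at hl
        have h3 : a y * (b y * U / (a y * V)) = b y * (U / V) := by field_simp
        have h4 := mul_le_mul_of_nonneg_left hl hy.le
        rw [mul_sub (a y) (b y * U / (a y * V)), h3] at h4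
        linarith
    have h5 := sum_le_sum fun y (_ : y ∈ univ) => this y
    rw [sum_sub_distrib, sum_add_distrib, ← sum_mul, ← sum_mul, ← hU, ← hV,
      mul_div_cancel₀ _ hB.ne'] at h5
    rw [relEnt]; linarith

lemma relEnt_nonneg {S : Type*} [Fintype S] {a b : S → ℝ} (ha : a ∈ stdSimplex ℝ S)
    (hb : b ∈ stdSimplex ℝ S) (hab : ∀ y, b y = 0 → a y = 0) : 0 ≤ relEnt a b := by
  simpa [ha.2, hb.2] using log_sum_le ha.1 hb.1 hab

variable {X A : Type*} [Fintype X] [Fintype A] {N : ℕ}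

/-- A strictly positive policy reaches every pair that the kernel and the initial distribution
allow, so its law dominates that of any other policy. -/
lemma occ_eq_zero {p : Fin N → X × A → X → ℝ} {π π' : Fin N → X → A → ℝ} {ν : X × A → ℝ}
    (hp : IsKernel p) (hπ' : IsPolicy π') (hpos : ∀ i x a, 0 < π' i x a)
    (hν : ν ∈ stdSimplex ℝ (X × A)) {n : Fin (N + 1)} {y : X × A} (h : occ p π' ν n y = 0) :
    occ p π ν n y = 0 := by
  induction n using Fin.induction generalizing y with
  | zero => exact h
  | succ i ih =>
    rw [occ_succ] at h ⊢
    have h0 := (mul_eq_zero.1 h).resolve_right (hpos _ _ _).ne'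
    rw [sum_eq_zero_iff_of_nonneg fun z _ =>
      mul_nonneg ((occ_mem hp hπ' hν _).1 z) ((hp i z).1 _)] at h0
    rw [sum_eq_zero, zero_mul]
    intro z hz
    rcases mul_eq_zero.1 (h0 z hz) with h1 | h1
    · rw [ih h1, zero_mul]
    · rw [h1, mul_zero]

/-- The relative entropy of the induced distributions is at most that of the policies along the
trajectory. -/
lemma relEnt_occ_le {p : Fin N → X × A → X → ℝ} {π π' : Fin N → X → A → ℝ} {ν : X × A → ℝ}
    (hp : IsKernel p) (hπ : IsPolicy π) (hπ' : IsPolicy π') (hpos : ∀ i x a, 0 < π i x a)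
    (hpos' : ∀ i x a, 0 < π' i x a) (hν : ν ∈ stdSimplex ℝ (X × A)) (n : Fin (N + 1)) :
    relEnt (occ p π ν n) (occ p π' ν n) ≤
      pairing (fun i y => Real.log (π i y.1 y.2) - Real.log (π' i y.1 y.2)) (occ p π ν) := by
  set c : Fin N → ℝ := fun i =>
    ∑ y : X × A, (Real.log (π i y.1 y.2) - Real.log (π' i y.1 y.2)) * occ p π ν i.succ y with hcdef
  have hceq : ∀ i, c i = ∑ x, (∑ y, occ p π ν i.castSucc y * p i y x) *
      relEnt (π i x) (π' i x) := by
    intro i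
    simp only [hcdef, Fintype.sum_prod_type, relEnt, mul_sum, occ_succ]
    exact sum_congr rfl fun x _ => sum_congr rfl fun a _ => by ring
  have hm : ∀ (π : Fin N → X → A → ℝ), IsPolicy π → ∀ i x,
      0 ≤ ∑ y, occ p π ν i.castSucc y * p i y x := fun π hπ i x =>
    sum_nonneg fun y _ => mul_nonneg ((occ_mem hp hπ hν _).1 y) ((hp i y).1 x)
  have h := le_add_sum_of_succ_le (fun n => relEnt (occ p π ν n) (occ p π' ν n)) c ?_ ?_ n
  · have h0 : relEnt (occ p π ν 0) (occ p π' ν 0) = 0 := by simp [relEnt, occ_zero]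
    simp only [h0, zero_add] at h
    exact h
  · intro i
    rw [hceq]
    exact sum_nonneg fun x _ => mul_nonneg (hm π hπ i x)
      (relEnt_nonneg (hπ i x) (hπ' i x) fun a ha => absurd ha (hpos' i x a).ne')
  · intro i
    set m := fun x => ∑ y, occ p π ν i.castSucc y * p i y x with hmdef
    set m' := fun x => ∑ y, occ p π' ν i.castSucc y * p i y x with hmdef'
    have hmm : ∀ x, m' x = 0 → m x = 0 := by
      intro x hx
      obtain ⟨a, -, -⟩ := exists_ne_zero_of_sum_ne_zero ((hπ i x).2.trans_ne one_ne_zero)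
      have h0 : occ p π' ν i.succ (x, a) = 0 := by
        rw [occ_succ]; exact mul_eq_zero_of_left hx _
      have h1 := occ_eq_zero (π := π) hp hπ' hpos' hν h0
      rw [occ_succ] at h1
      exact (mul_eq_zero.1 h1).resolve_right (hpos _ _ _).ne'
    -- Chain rule: entropy of the state marginals plus the conditional entropy of the actions,
    -- averaged under the first law.
    have h1 : relEnt (occ p π ν i.succ) (occ p π' ν i.succ) = relEnt m m' + c i := by
      rw [hceq, relEnt, relEnt, Fintype.sum_prod_type, ← sum_add_distrib]
      refine sum_congr rfl fun x _ => ?_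
      have : ∀ a, occ p π ν i.succ (x, a) *
          (Real.log (occ p π ν i.succ (x, a)) - Real.log (occ p π' ν i.succ (x, a))) =
          (m x * (Real.log (m x) - Real.log (m' x))) * π i x a +
            m x * (π i x a * (Real.log (π i x a) - Real.log (π' i x a))) := by
        intro a
        have e1 : occ p π ν i.succ (x, a) = m x * π i x a := occ_succ _ _ _ _ _
        have e2 : occ p π' ν i.succ (x, a) = m' x * π' i x a := occ_succ _ _ _ _ _
        rw [e1, e2]
        by_cases hx : m x = 0
        · simp [hx]
        · rw [Real.log_mul hx (hpos _ _ _).ne',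
            Real.log_mul (fun h => hx (hmm x h)) (hpos' _ _ _).ne']
          ring
      simp only [this, sum_add_distrib, ← mul_sum, (hπ i x).2, mul_one]
      rfl
    -- Data processing: both laws pass through the same kernel, so the log-sum inequality applies at
    -- each state.
    have h2 : relEnt m m' ≤ relEnt (occ p π ν i.castSucc) (occ p π' ν i.castSucc) := by
      have h3 : ∀ x, m x * (Real.log (m x) - Real.log (m' x)) ≤
          ∑ y, occ p π ν i.castSucc y * p i y x *
            (Real.log (occ p π ν i.castSucc y) - Real.log (occ p π' ν i.castSucc y)) := by
        intro x
        refine (log_sum_le (a := fun y => occ p π ν i.castSucc y * p i y x)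
          (b := fun y => occ p π' ν i.castSucc y * p i y x)
          (fun y => mul_nonneg ((occ_mem hp hπ hν _).1 y) ((hp i y).1 x))
          (fun y => mul_nonneg ((occ_mem hp hπ' hν _).1 y) ((hp i y).1 x)) ?_).trans
          (le_of_eq (sum_congr rfl fun y _ => ?_))
        · intro y hy
          rcases mul_eq_zero.1 hy with h | h
          · simp only [occ_eq_zero (π := π) hp hπ' hpos' hν h, zero_mul]
          · simp only [h, mul_zero]
        · by_cases h0 : occ p π ν i.castSucc y = 0
          · simp [h0]
          by_cases h1 : p i y x = 0
          · simp [h1]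
          have h2 : occ p π' ν i.castSucc y ≠ 0 := fun h =>
            h0 (occ_eq_zero (π := π) hp hπ' hpos' hν h)
          simp only [Real.log_mul h0 h1, Real.log_mul h2 h1]
          ring
      refine (sum_le_sum fun x _ => h3 x).trans (le_of_eq ?_)
      rw [sum_comm, relEnt]
      refine sum_congr rfl fun y _ => ?_
      rw [← sum_mul, ← mul_sum, (hp i y).2, mul_one]
    show relEnt (occ p π ν i.succ) (occ p π' ν i.succ) ≤ _ + c i
    rw [h1]
    linarith

/-! ### First-order optimality for both divergences, and convexity of the constraint sets. -/

/-- Serves both divergences: `M = 1`, `D = 0` for `kl`, and the state marginal with its increment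
for `gamma`. In each case the terms `d - D * (u / M)` sum to zero, leaving the difference of the
gradients. -/
lemma hasDerivAt_mul_log {u d M D c : ℝ} (hu : 0 < u) (hM : 0 < M) (hc : 0 < c) :
    HasDerivAt (fun s : ℝ => (u + s * d) * Real.log ((u + s * d) / (M + s * D) / c))
      (d * (Real.log (u / M) - Real.log c) + d - D * (u / M)) 0 := by
  have h1 : HasDerivAt (fun s : ℝ => u + s * d) d 0 := by
    simpa using ((hasDerivAt_id (0 : ℝ)).mul_const d).const_add u
  have h2 : HasDerivAt (fun s : ℝ => M + s * D) D 0 := by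
    simpa using ((hasDerivAt_id (0 : ℝ)).mul_const D).const_add M
  have h3 := h1.mul (((h1.div h2 (by simpa using hM.ne')).div_const c).log (by
    simp; exact ⟨⟨hu.ne', hM.ne'⟩, hc.ne'⟩))
  refine h3.congr_deriv ?_
  simp only [Pi.div_apply, zero_mul, add_zero]
  rw [Real.log_div (by positivity) hc.ne']
  field_simp
  ring

lemma nonneg_of_hasDerivAt {φ : ℝ → ℝ} {c : ℝ} (h : HasDerivAt φ c 0)
    (hmin : ∀ s ∈ Set.Icc (0 : ℝ) 1, φ 0 ≤ φ s) : 0 ≤ c := by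
  have ht := (hasDerivWithinAt_iff_tendsto_slope' (by simp)).1 (h.hasDerivWithinAt (s := Set.Ioi 0))
  refine ge_of_tendsto ht ?_
  filter_upwards [Ioc_mem_nhdsGT (show (0 : ℝ) < 1 by norm_num)] with s hs
  rw [slope_def_field]
  exact div_nonneg (sub_nonneg.2 (hmin s ⟨hs.1.le, hs.2⟩)) (by linarith [hs.1])

lemma hasDerivAt_pairing (z : Fin N → X × A → ℝ) (μ d : Fin (N + 1) → X × A → ℝ) (η : ℝ) :
    HasDerivAt (fun s : ℝ => η * pairing z (μ + s • d)) (η * pairing z d) 0 := by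
  have : ∀ s : ℝ, η * pairing z (μ + s • d) = η * pairing z μ + s * (η * pairing z d) := by
    intro s
    have : pairing z (μ + s • d) = pairing z μ + s * pairing z d := by
      simp only [pairing, mul_sum, ← sum_add_distrib, Pi.add_apply, Pi.smul_apply, smul_eq_mul]
      exact sum_congr rfl fun i _ => sum_congr rfl fun y _ => by ring
    rw [this]; ring
  simp only [this]
  simpa using ((hasDerivAt_id (0 : ℝ)).mul_const (η * pairing z d)).const_add (η * pairing z μ)

/-- Along the segment from `μ` to `ν`, which stays in `C`, the objective is least at the left
endpoint, so its derivative there is nonnegative. -/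
lemma first_order_of_hasDerivAt {D : Div} {C : Set (Fin (N + 1) → X × A → ℝ)} (hC : Convex ℝ C)
    {μ ν μ' : Fin (N + 1) → X × A → ℝ} (hμ : μ ∈ C) (hν : ν ∈ C) {π' : Fin N → X → A → ℝ} {η : ℝ}
    {z : Fin N → X × A → ℝ} (hmin : IsMinOn (fun μ => η * pairing z μ + D.val μ μ' π') C μ) {c : ℝ}
    (hd : HasDerivAt (fun s : ℝ => D.val (μ + s • (ν - μ)) μ' π') c 0) :
    0 ≤ η * pairing z (ν - μ) + c := by
  refine nonneg_of_hasDerivAt ((hasDerivAt_pairing z μ (ν - μ) η).add hd) fun s hs => ?_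
  have hm := hC.add_smul_sub_mem hμ hν hs
  simpa using hmin hm

/-- The first-order optimality condition for the divergence `kl`. -/
lemma kl_first_order {C : Set (Fin (N + 1) → X × A → ℝ)} (hC : Convex ℝ C)
    {μ ν μ' : Fin (N + 1) → X × A → ℝ} (hμ : μ ∈ C) (hν : ν ∈ C) {π π' : Fin N → X → A → ℝ} {η : ℝ}
    {z : Fin N → X × A → ℝ} (hmin : IsMinOn (fun μ => η * pairing z μ + Div.kl.val μ μ' π') C μ)
    (h0 : ν 0 = μ 0) (hsum : ∀ n, ∑ y, ν n y = ∑ y, μ n y)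
    (hpos : Div.kl.Regular μ π) (hpos' : Div.kl.Regular μ' π') :
    0 ≤ η * pairing z (ν - μ) + pairing (Div.kl.grad μ π - Div.kl.grad μ' π') (ν - μ) := by
  refine first_order_of_hasDerivAt hC hμ hν hmin ?_
  -- The term of step 0 does not move, because `ν` and `μ` agree there; `1 + s * 0` is the marginal
  -- slot of `hasDerivAt_mul_log`.
  have hval : ∀ s : ℝ, Div.kl.val (μ + s • (ν - μ)) μ' π' =
      ∑ y, μ 0 y * Real.log (μ 0 y / μ' 0 y) + ∑ i : Fin N, ∑ y,
        (μ i.succ y + s * (ν - μ) i.succ y) *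
          Real.log ((μ i.succ y + s * (ν - μ) i.succ y) / (1 + s * 0) / μ' i.succ y) := by
    intro s
    simp only [Div.val]
    rw [Fin.sum_univ_succ]
    simp [h0]
  simp only [hval]
  have hd := (HasDerivAt.fun_sum fun i (_ : i ∈ (univ : Finset (Fin N))) =>
    HasDerivAt.fun_sum fun y (_ : y ∈ (univ : Finset (X × A))) =>
      hasDerivAt_mul_log (d := (ν - μ) i.succ y) (D := 0) (hpos i y) one_pos
        (hpos' i y)).const_add (∑ y, μ 0 y * Real.log (μ 0 y / μ' 0 y))
  refine hd.congr_deriv ?_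
  symm
  refine sum_congr rfl fun i _ => ?_
  have : ∑ y, (ν i.succ y - μ i.succ y) = 0 := by rw [sum_sub_distrib, hsum, sub_self]
  simp only [div_one, zero_mul, sub_zero, sum_add_distrib, this, add_zero, Div.grad, Pi.sub_apply]
  exact sum_congr rfl fun y _ => by ring

/-- The first-order optimality condition for the divergence `gamma`. -/
lemma gamma_first_order {C : Set (Fin (N + 1) → X × A → ℝ)} (hC : Convex ℝ C)
    {μ ν μ' : Fin (N + 1) → X × A → ℝ} (hμ : μ ∈ C) (hν : ν ∈ C) {π π' : Fin N → X → A → ℝ} {η : ℝ}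
    {z : Fin N → X × A → ℝ} (hmin : IsMinOn (fun μ => η * pairing z μ + Div.gamma.val μ μ' π') C μ)
    (h0 : ν 0 = μ 0) (hnn : ∀ n y, 0 ≤ μ n y)
    (hπ : ∀ (i : Fin N) x a, μ i.succ (x, a) = (∑ b, μ i.succ (x, b)) * π i x a)
    (hac : ∀ (i : Fin N) y, μ i.succ y = 0 → ν i.succ y = 0)
    (hpos : Div.gamma.Regular μ π) (hpos' : Div.gamma.Regular μ' π') :
    0 ≤ η * pairing z (ν - μ) + pairing (Div.gamma.grad μ π - Div.gamma.grad μ' π') (ν - μ) := by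
  refine first_order_of_hasDerivAt hC hμ hν hmin ?_
  have hval : ∀ s : ℝ, Div.gamma.val (μ + s • (ν - μ)) μ' π' =
      ∑ i : Fin N, ∑ x, ∑ a,
        (μ i.succ (x, a) + s * (ν - μ) i.succ (x, a)) *
          Real.log ((μ i.succ (x, a) + s * (ν - μ) i.succ (x, a)) /
            ((∑ b, μ i.succ (x, b)) + s * ∑ b, (ν - μ) i.succ (x, b)) / π' i x a) +
      ∑ y, μ 0 y * Real.log (μ 0 y / μ' 0 y) := by
    intro s
    simp [Div.val, h0, sum_add_distrib, ← mul_sum]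
  simp only [hval]
  have key : ∀ (i : Fin N) (x : X), HasDerivAt (fun s : ℝ => ∑ a,
        (μ i.succ (x, a) + s * (ν - μ) i.succ (x, a)) *
          Real.log ((μ i.succ (x, a) + s * (ν - μ) i.succ (x, a)) /
            ((∑ b, μ i.succ (x, b)) + s * ∑ b, (ν - μ) i.succ (x, b)) / π' i x a))
      (∑ a, (Div.gamma.grad μ π - Div.gamma.grad μ' π') i (x, a) * (ν - μ) i.succ (x, a)) 0 := by
    intro i x
    -- At a state without mass, `ν` has no mass either, so the summand vanishes along the whole
    -- segment and the singular logarithm does not matter.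
    rcases (sum_nonneg fun b (_ : b ∈ univ) => hnn i.succ (x, b)).eq_or_lt with hM | hM
    · have e1 : ∀ a, μ i.succ (x, a) = 0 := fun a => by rw [hπ, ← hM, zero_mul]
      have e2 : ∀ a, ν i.succ (x, a) = 0 := fun a => hac _ _ (e1 a)
      simp [e1, e2, hasDerivAt_const]
    · have hu : ∀ a, 0 < μ i.succ (x, a) := fun a => by
        rw [hπ]; exact mul_pos hM (hpos i x a)
      have hd := HasDerivAt.fun_sum fun a (_ : a ∈ (univ : Finset A)) =>
        hasDerivAt_mul_log (d := (ν - μ) i.succ (x, a)) (D := ∑ b, (ν - μ) i.succ (x, b)) (hu a) hM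
          (hpos' i x a)
      refine hd.congr_deriv ?_
      symm
      have hr : ∀ a, μ i.succ (x, a) / ∑ b, μ i.succ (x, b) = π i x a := fun a => by
        rw [div_eq_iff hM.ne', mul_comm]; exact hπ i x a
      have h1 : ∑ a, π i x a = 1 := by
        simp only [← hr, ← sum_div, div_self hM.ne']
      simp only [hr, sum_sub_distrib, sum_add_distrib, ← mul_sum, h1, mul_one, add_sub_cancel_right,
        Div.grad, Pi.sub_apply]
      exact sum_congr rfl fun a _ => by ring
  refine ((HasDerivAt.fun_sum fun i (_ : i ∈ (univ : Finset (Fin N))) =>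
    HasDerivAt.fun_sum fun x (_ : x ∈ (univ : Finset X)) => key i x).add_const
      (∑ y, μ 0 y * Real.log (μ 0 y / μ' 0 y))).congr_deriv ?_
  simp only [pairing, Fintype.sum_prod_type]

lemma convex_flowSet (p : Fin N → X × A → X → ℝ) (ρ : X × A → ℝ) : Convex ℝ (flowSet p ρ) := by
  intro μ hμ μ' hμ' s t hs ht hst
  refine ⟨fun n => (convex_stdSimplex ℝ _) (hμ.1 n) (hμ'.1 n) hs ht hst, ?_, fun i x => ?_⟩
  · have : (s • μ + t • μ') 0 = s • μ 0 + t • μ' 0 := rfl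
    rw [this, hμ.2.1, hμ'.2.1, ← add_smul, hst, one_smul]
  · have h1 := hμ.2.2 i x
    have h2 := hμ'.2.2 i x
    simp only [Pi.add_apply, Pi.smul_apply, smul_eq_mul, sum_add_distrib, ← mul_sum, h1, h2,
      add_mul, mul_assoc]

/-- The distance to `ρ` is convex in `μ`, while the bonus side of the constraint is affine. -/
lemma convex_constraintSet (T : ℕ) (δ α : ℝ) (ρ ρt : X × A → ℝ) (h : ℕ → Fin (N + 1) → X × A)
    (t : ℕ) : Convex ℝ (constraintSet T δ α ρ ρt h t) := by
  intro μ hμ μ' hμ' s r hs hr hsr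
  refine ⟨convex_flowSet _ _ hμ.1 hμ'.1 hs hr hsr, ?_⟩
  have h1 := mul_le_mul_of_nonneg_left hμ.2 hs
  have h2 := mul_le_mul_of_nonneg_left hμ'.2 hr
  have h3 : l1 ((s • μ + r • μ') (Fin.last N) - ρ) ≤
      s * l1 (μ (Fin.last N) - ρ) + r * l1 (μ' (Fin.last N) - ρ) := by
    simp only [l1, mul_sum, ← sum_add_distrib]
    refine sum_le_sum fun y _ => ?_
    have : ((s • μ + r • μ') (Fin.last N) - ρ) y =
        s * (μ (Fin.last N) - ρ) y + r * (μ' (Fin.last N) - ρ) y := by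
      simp only [Pi.sub_apply, Pi.add_apply, Pi.smul_apply, smul_eq_mul]
      linear_combination (ρ y) * hsr
    rw [this]
    refine (abs_add_le _ _).trans ?_
    rw [abs_mul, abs_mul, abs_of_nonneg hs, abs_of_nonneg hr]
  refine h3.trans ((add_le_add h1 h2).trans (le_of_eq ?_))
  simp only [Pi.add_apply, Pi.smul_apply, smul_eq_mul, add_mul, sum_add_distrib, mul_assoc,
    ← mul_sum]
  linear_combination (α * l1 (ρt - ρ)) * hsr

end Divergence

/-! ### Exponential supermartingales along adapted observations. -/

section Probability

/-- Hoeffding's lemma on a finite probability space, for a variable with values in `[-1, 1]`. -/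
lemma sum_mul_exp_le {S : Type*} [Fintype S] {w : S → ℝ} (hw : w ∈ stdSimplex ℝ S) {v : S → ℝ}
    (hv : ∀ x, v x ∈ Set.Icc (-1 : ℝ) 1) (c : ℝ) :
    ∑ x, w x * Real.exp (c * (v x - ∑ y, w y * v y)) ≤ Real.exp (c ^ 2 / 2) := by
  let _ : MeasurableSpace S := ⊤
  let q : PMF S := PMF.ofFintype (fun x => ENNReal.ofReal (w x)) (by
    rw [← ENNReal.ofReal_sum_of_nonneg fun x _ => hw.1 x, hw.2, ENNReal.ofReal_one])
  have hq : ∀ f : S → ℝ, ∫ x, f x ∂q.toMeasure = ∑ x, w x * f x := by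
    intro f
    rw [PMF.integral_eq_sum]
    refine sum_congr rfl fun x _ => ?_
    simp [q, PMF.ofFintype_apply, ENNReal.toReal_ofReal (hw.1 x)]
  -- The interval has half-length 1, so the sub-Gaussian parameter is 1.
  have h := (hasSubgaussianMGF_of_mem_Icc (μ := q.toMeasure) (X := v)
    (measurable_of_finite v).aemeasurable (Filter.Eventually.of_forall hv)).mgf_le c
  rw [mgf, hq, hq] at h
  refine h.trans (le_of_eq ?_)
  norm_num

variable {Ω : Type*} [mΩ : MeasurableSpace Ω] {P : Measure Ω} [IsProbabilityMeasure P]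
  {ℱ : Filtration ℕ mΩ} {S : Type*} [Fintype S] {T : ℕ}

/-- A product of weights along a sequence of observations has expectation at most `1` if each weight
has conditional expectation at most `1`. -/
lemma integral_prod_le_one {τ : ℕ → Ω → S} {q W : ℕ → Ω → S → ℝ} {B : ℝ}
    (hmeas : ∀ t < T, ∀ s, MeasurableSet[ℱ (t + 1)] {ω | τ t ω = s})
    (hlaw : ∀ t < T, ∀ s, P[Set.indicator {ω | τ t ω = s} (fun _ => (1 : ℝ)) | ℱ t] =ᵐ[P]
      fun ω => q t ω s)
    (hW : ∀ t < T, ∀ s, Measurable[ℱ t] fun ω => W t ω s) (h0 : ∀ t ω s, 0 ≤ W t ω s)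
    (hB : ∀ t < T, ∀ ω s, W t ω s ≤ B) (hq : ∀ t < T, ∀ ω, ∑ s, q t ω s * W t ω s ≤ 1)
    {n : ℕ} (hn : n ≤ T) :
    Measurable[ℱ n] (fun ω => ∏ t ∈ range n, W t ω (τ t ω)) ∧
      ∫ ω, ∏ t ∈ range n, W t ω (τ t ω) ∂P ≤ 1 := by
  classical
  have hbd : ∀ k ≤ T, ∀ ω, ∏ t ∈ range k, W t ω (τ t ω) ≤ B ^ k := fun k hk ω => by
    refine (prod_le_prod (fun t _ => h0 t ω _) fun t ht => hB t ?_ ω _).trans (by simp)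
    exact (mem_range.1 ht).trans_le hk
  have hnn : ∀ k ω, 0 ≤ ∏ t ∈ range k, W t ω (τ t ω) := fun k ω =>
    prod_nonneg fun t _ => h0 t ω _
  induction n with
  | zero => simp
  | succ n ih =>
    obtain ⟨hm, hi⟩ := ih (by omega)
    have hnT : n < T := hn
    set Z : Ω → ℝ := fun ω => ∏ t ∈ range n, W t ω (τ t ω) with hZ
    -- Splitting over the value of the new observation separates an `ℱ n`-measurable factor from an
    -- indicator, whose conditional expectation is the prescribed law. The bound `B` serves only
    -- integrability.
    have hstep : (fun ω => ∏ t ∈ range (n + 1), W t ω (τ t ω)) =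
        fun ω => ∑ s, (Z ω * W n ω s) * Set.indicator {ω | τ n ω = s} (fun _ => (1 : ℝ)) ω := by
      ext ω
      rw [prod_range_succ, sum_eq_single (τ n ω)]
      · simp [hZ]
      · intro s _ hs
        simp [Ne.symm hs]
      · simp
    have hZW : ∀ s, Measurable[ℱ n] fun ω => Z ω * W n ω s := fun s => hm.mul (hW n hnT s)
    have hint1 : ∀ s, Integrable (Set.indicator {ω | τ n ω = s} (fun _ => (1 : ℝ))) P := fun s =>
      (integrable_const _).indicator (ℱ.le _ _ (hmeas n hnT s))
    have hint : ∀ s, Integrable ((fun ω => Z ω * W n ω s) *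
        Set.indicator {ω | τ n ω = s} (fun _ => (1 : ℝ))) P := by
      intro s
      refine (hint1 s).bdd_mul (c := B ^ n * B)
        ((hZW s).mono (ℱ.le n) le_rfl).aestronglyMeasurable ?_
      refine Filter.Eventually.of_forall fun ω => ?_
      rw [Real.norm_eq_abs, abs_of_nonneg (mul_nonneg (hnn n ω) (h0 n ω s))]
      exact mul_le_mul (hbd n hnT.le ω) (hB n hnT ω s) (h0 n ω s)
        ((hnn n ω).trans (hbd n hnT.le ω))
    have hcond : ∀ s, P[(fun ω => Z ω * W n ω s) *
        Set.indicator {ω | τ n ω = s} (fun _ => (1 : ℝ)) | ℱ n] =ᵐ[P]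
        fun ω => Z ω * (q n ω s * W n ω s) := by
      intro s
      refine (condExp_mul_of_stronglyMeasurable_left (hZW s).stronglyMeasurable (hint s)
        (hint1 s)).trans ?_
      filter_upwards [hlaw n hnT s] with ω hω
      rw [Pi.mul_apply, hω]; ring
    constructor
    · rw [hstep]
      refine Finset.measurable_sum _ fun s _ => Measurable.mul ?_ ?_
      · exact (hZW s).mono (ℱ.mono (Nat.le_succ n)) le_rfl
      · exact measurable_const.indicator (hmeas n hnT s)
    · have hsum := integral_finsetSum univ fun s _ => hint s
      simp only [Pi.mul_apply] at hsum
      rw [hstep, hsum]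
      have h1 : ∀ s, ∫ ω, (Z ω * W n ω s) * Set.indicator {ω | τ n ω = s} (fun _ => (1 : ℝ)) ω ∂P =
          ∫ ω, Z ω * (q n ω s * W n ω s) ∂P := by
        intro s
        rw [← integral_congr_ae (hcond s), integral_condExp (ℱ.le n)]
        rfl
      have hint2 : ∀ s, Integrable (fun ω => Z ω * (q n ω s * W n ω s)) P := fun s =>
        integrable_condExp.congr (hcond s)
      simp only [h1]
      rw [← integral_finsetSum _ fun s _ => hint2 s]
      refine le_trans (integral_mono (integrable_finsetSum _ fun s _ => hint2 s) ?_ fun ω => ?_) hi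
      · refine Integrable.of_bound (C := B ^ n)
          (hm.mono (ℱ.le n) le_rfl).aestronglyMeasurable ?_
        refine Filter.Eventually.of_forall fun ω => ?_
        rw [Real.norm_eq_abs, abs_of_nonneg (hnn n ω)]
        exact hbd n hnT.le ω
      · show ∑ s, Z ω * (q n ω s * W n ω s) ≤ Z ω
        rw [← mul_sum]
        exact mul_le_of_le_one_right (hnn n ω) (hq n hnT ω)

/-- Markov's inequality for the products of weights. -/
lemma measureReal_prod_ge_le {τ : ℕ → Ω → S} {q W : ℕ → Ω → S → ℝ} {B : ℝ}
    (hmeas : ∀ t < T, ∀ s, MeasurableSet[ℱ (t + 1)] {ω | τ t ω = s})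
    (hlaw : ∀ t < T, ∀ s, P[Set.indicator {ω | τ t ω = s} (fun _ => (1 : ℝ)) | ℱ t] =ᵐ[P]
      fun ω => q t ω s)
    (hW : ∀ t < T, ∀ s, Measurable[ℱ t] fun ω => W t ω s) (h0 : ∀ t ω s, 0 ≤ W t ω s)
    (hB : ∀ t < T, ∀ ω s, W t ω s ≤ B) (hq : ∀ t < T, ∀ ω, ∑ s, q t ω s * W t ω s ≤ 1)
    {n : ℕ} (hn : n ≤ T) (a : ℝ) :
    P.real {ω | Real.exp a ≤ ∏ t ∈ range n, W t ω (τ t ω)} ≤ Real.exp (-a) := by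
  obtain ⟨hm, hi⟩ := integral_prod_le_one hmeas hlaw hW h0 hB hq hn
  have hnn : ∀ ω, 0 ≤ ∏ t ∈ range n, W t ω (τ t ω) := fun ω => prod_nonneg fun t _ => h0 t ω _
  have hint : Integrable (fun ω => ∏ t ∈ range n, W t ω (τ t ω)) P := by
    refine Integrable.of_bound (C := B ^ n) (hm.mono (ℱ.le n) le_rfl).aestronglyMeasurable ?_
    refine Filter.Eventually.of_forall fun ω => ?_
    rw [Real.norm_eq_abs, abs_of_nonneg (hnn ω)]
    refine (prod_le_prod (fun t _ => h0 t ω _) fun t ht => hB t ?_ ω _).trans (by simp)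
    exact (mem_range.1 ht).trans_le hn
  have h := (mul_meas_ge_le_integral_of_nonneg (Filter.Eventually.of_forall hnn) hint
    (Real.exp a)).trans hi
  rw [Real.exp_neg, ← one_div, le_div_iff₀ (Real.exp_pos a), mul_comm]
  exact h

end Probability

/-! ### Laws of trajectories and their marginals. -/

section Paths

variable {X A : Type*} [Fintype X] [Fintype A]

lemma sum_fin_cons {S : Type*} [Fintype S] {n : ℕ} (f : (Fin (n + 1) → S) → ℝ) :
    ∑ τ, f τ = ∑ y, ∑ τ : Fin n → S, f (Fin.cons y τ) := by
  rw [← (Fin.consEquiv fun _ : Fin (n + 1) => S).sum_comp, Fintype.sum_prod_type]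
  rfl

/-- One step of the dynamics. -/
noncomputable def step (p : X × A → X → ℝ) (π : X → A → ℝ) (ν : X × A → ℝ) : X × A → ℝ :=
  fun z => (∑ y, ν y * p y z.1) * π z.1 z.2

/-- Fixing the first pair leaves a path of the shifted MDP with an unnormalized initial weight. This
drives the inductions below, and explains why their initial vectors are arbitrary. -/
lemma pathProb_cons {N : ℕ} (p : Fin (N + 1) → X × A → X → ℝ) (π : Fin (N + 1) → X → A → ℝ)
    (ν : X × A → ℝ) (y : X × A) (τ : Fin (N + 1) → X × A) :
    pathProb p π ν (Fin.cons y τ : Fin (N + 2) → X × A) =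
      pathProb (fun i => p i.succ) (fun i => π i.succ)
        (fun z => ν y * p 0 y z.1 * π 0 z.1 z.2) τ := by
  simp only [pathProb]
  rw [Fin.prod_univ_succ]
  simp only [Fin.cons_zero, Fin.cons_succ, Fin.castSucc_zero, ← Fin.succ_castSucc]
  ring

lemma sum_step (p : X × A → X → ℝ) {π : X → A → ℝ}
    (hπ : ∀ x, π x ∈ stdSimplex ℝ A) (c : X × A → ℝ) (f : X → ℝ) (y : X × A) :
    ∑ z : X × A, c y * p y z.1 * π z.1 z.2 * f z.1 = c y * ∑ x, p y x * f x := by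
  rw [Fintype.sum_prod_type, mul_sum]
  refine sum_congr rfl fun x _ => ?_
  simp only
  have : ∀ a, c y * p y x * π x a * f x = c y * p y x * f x * π x a := fun a => by ring
  simp only [this, ← mul_sum, (hπ x).2]
  ring

lemma sum_pathProb {N : ℕ} {p : Fin N → X × A → X → ℝ} {π : Fin N → X → A → ℝ}
    (hp : IsKernel p) (hπ : IsPolicy π) (ν : X × A → ℝ) : ∑ τ, pathProb p π ν τ = ∑ y, ν y := by
  induction N generalizing ν with
  | zero =>
    rw [sum_fin_cons]
    simp [pathProb]
  | succ N ih =>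
    rw [sum_fin_cons]
    refine sum_congr rfl fun y _ => ?_
    simp only [pathProb_cons]
    rw [ih (p := fun i => p i.succ) (π := fun i => π i.succ) (fun i => hp _) (fun i => hπ _)]
    have := sum_step (p 0) (hπ 0) ν (fun _ => 1) y
    simpa [(hp 0 y).2] using this

/-- Path weights are linear in the initial vector, so a factor depending on the first pair can be
absorbed into it. -/
lemma pathProb_mul_zero {N : ℕ} (p : Fin N → X × A → X → ℝ) (π : Fin N → X → A → ℝ)
    (ν φ : X × A → ℝ) (τ : Fin (N + 1) → X × A) :
    pathProb p π ν τ * φ (τ 0) = pathProb p π (fun y => ν y * φ y) τ := by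
  simp only [pathProb]; ring

lemma sum_pathProb_left {N : ℕ} (p : Fin N → X × A → X → ℝ) (π : Fin N → X → A → ℝ) {ι : Type*}
    [Fintype ι] (ν : ι → X × A → ℝ) (τ : Fin (N + 1) → X × A) :
    ∑ j, pathProb p π (ν j) τ = pathProb p π (fun y => ∑ j, ν j y) τ := by
  simp only [pathProb, sum_mul]

lemma occ_succ_eq {N : ℕ} (p : Fin (N + 1) → X × A → X → ℝ) (π : Fin (N + 1) → X → A → ℝ)
    (ν : X × A → ℝ) (n : Fin (N + 1)) :
    occ p π ν n.succ =
      occ (fun i => p i.succ) (fun i => π i.succ) (step (p 0) (π 0) ν) n := by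
  induction n using Fin.induction with
  | zero =>
    ext z
    rw [occ_succ]
    rfl
  | succ i ih =>
    ext z
    rw [occ_succ, occ_succ, ← ih, Fin.succ_castSucc]

/-- The law of a transition along a random trajectory. -/
lemma sum_pathProb_transition {N : ℕ} {p : Fin N → X × A → X → ℝ} {π : Fin N → X → A → ℝ}
    (hp : IsKernel p) (hπ : IsPolicy π) (ν : X × A → ℝ) (i : Fin N) (f : X × A → X → ℝ) :
    ∑ τ, pathProb p π ν τ * f (τ i.castSucc) (τ i.succ).1 =
      ∑ y, occ p π ν i.castSucc y * ∑ x, p i y x * f y x := by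
  induction N generalizing ν with
  | zero => exact i.elim0
  | succ N ih =>
    rw [sum_fin_cons]
    simp only [pathProb_cons]
    refine Fin.cases ?_ (fun j => ?_) i
    · simp only [Fin.castSucc_zero, Fin.cons_zero, Fin.cons_succ, occ_zero]
      refine sum_congr rfl fun y _ => ?_
      rw [← sum_step (p 0) (hπ 0)]
      have := fun τ => pathProb_mul_zero (fun i : Fin N => p i.succ) (fun i => π i.succ)
        (fun z => ν y * p 0 y z.1 * π 0 z.1 z.2) (fun z => f y z.1) τ
      simp only [this]
      exact sum_pathProb (fun i => hp _) (fun i => hπ _) _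
    -- For a later transition, the first pair is summed out, which replaces the initial vector by
    -- its image under one step of the dynamics.
    · simp only [← Fin.succ_castSucc, Fin.cons_succ]
      rw [sum_comm]
      simp only [← sum_mul, sum_pathProb_left]
      rw [occ_succ_eq]
      exact ih (p := fun i => p i.succ) (π := fun i => π i.succ) (fun i => hp _) (fun i => hπ _)
        (step (p 0) (π 0) ν) j

lemma pathProb_nonneg {N : ℕ} {p : Fin N → X × A → X → ℝ} {π : Fin N → X → A → ℝ}
    (hp : IsKernel p) (hπ : IsPolicy π) {ν : X × A → ℝ} (hν : ν ∈ stdSimplex ℝ (X × A))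
    (τ : Fin (N + 1) → X × A) : 0 ≤ pathProb p π ν τ :=
  mul_nonneg (hν.1 _) (prod_nonneg fun i _ => mul_nonneg ((hp i _).1 _) ((hπ i _).1 _))

end Paths

/-! ### The event on which the empirical kernels are accurate. -/

section Concentration

variable {X A : Type*} [Fintype X] [Fintype A] {N T : ℕ} {δ : ℝ}

/-- Duality reduces the norm to `2 ^ |S|` linear statistics, each fit for a scalar exponential
bound. -/
lemma l1_le_of_signs {S : Type*} [Fintype S] {w : S → ℝ} {M : ℝ}
    (h : ∀ b : S → Bool, ∑ x, (if b x then 1 else -1) * w x ≤ M) : l1 w ≤ M := by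
  classical
  refine le_trans (le_of_eq (sum_congr rfl fun x _ => ?_)) (h fun x => decide (0 ≤ w x))
  by_cases hx : 0 ≤ w x
  · simp [hx, abs_of_nonneg hx]
  · simp [hx, abs_of_neg (not_le.1 hx)]

-- Only visits to `y` contribute: each adds one centred term to the deviation and one unit to the
-- variance proxy, the visit count.
open Classical in
lemma prod_transition_weight (h : ℕ → Fin (N + 1) → X × A) (p : Fin N → X × A → X → ℝ) (i : Fin N)
    (y : X × A) (v : X → ℝ) (c : ℝ) (t : ℕ) :
    ∏ s ∈ range t, (if h s i.castSucc = y then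
        Real.exp (c * (v (h s i.succ).1 - ∑ x, p i y x * v x) - c ^ 2 / 2) else 1) =
      Real.exp (c * ∑ x, v x * (transitions h t i y x - visits h t i.castSucc y * p i y x) -
        c ^ 2 / 2 * visits h t i.castSucc y) := by
  induction t with
  | zero => simp [transitions, visits]
  | succ t ih =>
    rw [prod_range_succ, ih]
    by_cases hy : h t i.castSucc = y
    · rw [if_pos hy, ← Real.exp_add]
      congr 1
      have : ∑ x, v x * ((transitions h (t + 1) i y x : ℝ) -
          visits h (t + 1) i.castSucc y * p i y x) =
          ∑ x, v x * (transitions h t i y x - visits h t i.castSucc y * p i y x) +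
            (v (h t i.succ).1 - ∑ x, p i y x * v x) := by
        have : ∀ x, v x * ((transitions h (t + 1) i y x : ℝ) -
            visits h (t + 1) i.castSucc y * p i y x) =
            v x * (transitions h t i y x - visits h t i.castSucc y * p i y x) +
              ((if (h t i.succ).1 = x then v x else 0) - p i y x * v x) := by
          intro x
          rw [transitions_succ, visits_succ]
          simp only [hy, true_and, if_true]
          split_ifs <;> push_cast <;> ring
        simp only [this, sum_add_distrib, sum_sub_distrib, sum_ite_eq, mem_univ, if_true]
      rw [this, visits_succ, if_pos hy]
      push_cast
      ring
    · simp [hy, transitions_succ, visits_succ]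

variable {Ω : Type*} [mΩ : MeasurableSpace Ω] {P : Measure Ω} [IsProbabilityMeasure P]
  {ℱ : Filtration ℕ mΩ} {p : Fin N → X × A → X → ℝ} {ρ : X × A → ℝ}
  {traj : ℕ → Ω → Fin (N + 1) → X × A} {pol : ℕ → Ω → Fin N → X → A → ℝ}

/-- By Hoeffding's lemma each weight has conditional mean at most 1, so Markov's inequality applies
to the product. The rate `c` has to be deterministic, although the best one depends on the random
visit count. -/
lemma measureReal_transition_deviation_le (hp : IsKernel p) (hρ : ρ ∈ stdSimplex ℝ (X × A))
    (hobs : IsObservation P ℱ T p ρ traj pol) (i : Fin N) (y : X × A) {v : X → ℝ}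
    (hv : ∀ x, v x ∈ Set.Icc (-1 : ℝ) 1) (c a : ℝ) {t : ℕ} (ht : t ≤ T) :
    P.real {ω | Real.exp a ≤ Real.exp (c * ∑ x, v x *
      (transitions (fun s => traj s ω) t i y x - visits (fun s => traj s ω) t i.castSucc y * p i y x)
        - c ^ 2 / 2 * visits (fun s => traj s ω) t i.castSucc y)} ≤ Real.exp (-a) := by
  classical
  set w : X × A → X → ℝ := fun y' x => if y' = y then
    Real.exp (c * (v x - ∑ x, p i y x * v x) - c ^ 2 / 2) else 1 with hw
  set W : ℕ → Ω → (Fin (N + 1) → X × A) → ℝ := fun _ _ τ => w (τ i.castSucc) (τ i.succ).1 with hW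
  have hw0 : ∀ y' x, 0 ≤ w y' x := fun y' x => by
    simp only [hw]; split_ifs <;> positivity
  have h := measureReal_prod_ge_le (P := P) (ℱ := ℱ) (W := W) (T := T) (B := ∑ z, ∑ x, w z x)
    hobs.measurable_traj hobs.condLaw (fun t _ s => measurable_const) (fun t ω s => hw0 _ _)
    ?_ ?_ ht a
  · simp only [hW, hw, prod_transition_weight (fun s => traj s _)] at h
    exact h
  · intro _ _ ω τ
    refine (single_le_sum (fun x _ => hw0 _ x) (mem_univ (τ i.succ).1)).trans ?_
    exact single_le_sum (f := fun z => ∑ x, w z x) (fun z _ => sum_nonneg fun x _ => hw0 z x)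
      (mem_univ (τ i.castSucc))
  · intro t ht ω
    simp only [hW]
    have hpol := fun t ht => hobs.isPolicy t ht ω
    have hν := initDist_mem hp hρ hpol ht.le
    rw [sum_pathProb_transition hp (hpol t ht)]
    have hocc := occ_mem hp (hpol t ht) hν i.castSucc
    rw [← hocc.2]
    refine sum_le_sum fun y' _ => mul_le_of_le_one_right (hocc.1 y') ?_
    simp only [hw]
    split_ifs with hy
    · subst hy
      have := mul_le_mul_of_nonneg_right (sum_mul_exp_le (hp i y') hv c)
        (Real.exp_pos (-(c ^ 2 / 2))).le
      rw [← Real.exp_add, add_neg_cancel, Real.exp_zero, sum_mul] at this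
      refine le_trans (le_of_eq (sum_congr rfl fun x _ => ?_)) this
      rw [mul_assoc, ← Real.exp_add, sub_eq_add_neg (c * _)]
    · simp [(hp i y').2]

/-- With `ε = δ / (s a n t)` the exponential is `ε ^ s`. One factor `ε` cancels `s a n t` down to
`δ`, a second absorbs the other `t` (hence `2 ≤ s`), and the rest pair with powers of 2. -/
lemma union_bound_numeric {s : ℕ} {a n t : ℝ} (hs : 2 ≤ s) (ha : 1 ≤ a) (hn : 1 ≤ n) (ht : 1 ≤ t)
    (h0 : 0 < δ) (h1 : δ < 1) :
    n * (s * a * (2 ^ s * (t * t))) * Real.exp (-(s * Real.log (s * a * n * t / δ))) ≤ 2 * δ := by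
  have hs' : (2 : ℝ) ≤ s := by exact_mod_cast hs
  have hM : 0 < (s : ℝ) * a * n * t := by positivity
  set ε := δ / (s * a * n * t) with hε
  have hε0 : 0 < ε := div_pos h0 hM
  have he : Real.exp (-(s * Real.log (s * a * n * t / δ))) = ε ^ s := by
    rw [← mul_neg, ← Real.log_inv, inv_div, Real.exp_nat_mul, Real.exp_log hε0]
  have han : 1 ≤ a * n := one_le_mul_of_one_le_of_one_le ha hn
  have h2 : t * ε ≤ 1 / 2 := by
    rw [hε, mul_div_assoc', div_le_div_iff₀ hM (by norm_num)]
    have : 2 * 1 ≤ s * (a * n) := mul_le_mul hs' han (by norm_num) (by positivity)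
    nlinarith
  have hε1 : 2 * ε ≤ 1 := by nlinarith
  obtain ⟨k, rfl⟩ := Nat.exists_eq_add_of_le' hs
  rw [he]
  have e1 : n * ((k + 2 : ℕ) * a * (2 ^ (k + 2) * (t * t))) * ε ^ (k + 2) =
      (((k + 2 : ℕ) * a * n * t) * ε) * (4 * (t * ε)) * (2 * ε) ^ k := by
    rw [mul_pow]; ring
  rw [e1, hε, mul_div_cancel₀ _ hM.ne', ← hε]
  have h3 : (2 * ε) ^ k ≤ 1 := pow_le_one₀ (by positivity) hε1
  calc δ * (4 * (t * ε)) * (2 * ε) ^ k ≤ δ * (4 * (t * ε)) * 1 := by gcongr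
    _ ≤ 2 * δ := by nlinarith

/-- With high probability, the empirical kernels are within the bonuses of the true kernel. -/
lemma exists_kernel_event (hp : IsKernel p) (hρ : ρ ∈ stdSimplex ℝ (X × A))
    (hobs : IsObservation P ℱ T p ρ traj pol) [Nonempty X] (hA : 2 ≤ Fintype.card A) (hN : 1 ≤ N)
    (hT : 1 ≤ T) (h0 : 0 < δ) (h1 : δ < 1) :
    ∃ B : Set Ω, P.real B ≤ 2 * δ ∧ ∀ ω ∉ B, ∀ t < T, ∀ i y,
      l1 (p i y - empKernel (fun s => traj s ω) t i y) ≤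
        bonus T δ (fun s => traj s ω) t i.castSucc y := by
  classical
  have hb0 : ∀ ω t n y, 0 ≤ bonus T δ (fun s => traj s ω) t n y := fun ω t n y =>
    div_nonneg (Real.sqrt_nonneg _) (Real.sqrt_nonneg _)
  have hX : 1 ≤ Fintype.card X := Fintype.card_pos
  -- With a single state the two kernels coincide. Otherwise `Λ ≥ 1`, so `a ≥ 2` and the bonus of an
  -- unvisited pair is at least the trivial bound 2.
  rcases hX.eq_or_lt with hX1 | hX2
  · refine ⟨∅, by simpa using h0.le, fun ω _ t _ i y => ?_⟩
    have hs : Subsingleton X := Fintype.card_le_one_iff_subsingleton.1 hX1.ge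
    obtain ⟨x0⟩ := ‹Nonempty X›
    have : p i y - empKernel (fun s => traj s ω) t i y = 0 := by
      have huniq : ∀ w ∈ stdSimplex ℝ X, ∀ x, w x = 1 := fun w hw x => by
        rw [← hw.2, Fintype.sum_subsingleton _ x]
      ext x
      have : Nonempty X := ⟨x0⟩
      simp [huniq _ (hp i y), huniq _ (isKernel_empKernel _ t i y)]
    rw [this]
    refine le_trans (le_of_eq ?_) (hb0 ω t _ y)
    simp [l1]
  set s := Fintype.card X with hs
  have hs2 : (2 : ℝ) ≤ s := by exact_mod_cast hX2
  have hA2 : (2 : ℝ) ≤ Fintype.card A := by exact_mod_cast hA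
  have hN1 : (1 : ℝ) ≤ N := by exact_mod_cast hN
  have hT1 : (1 : ℝ) ≤ T := by exact_mod_cast hT
  set Λ := Real.log ((s : ℝ) * Fintype.card A * N * T / δ) with hΛ
  have hΛ2 : 1 ≤ Λ := by
    rw [hΛ, Real.le_log_iff_exp_le (by positivity)]
    have h4 : (4 : ℝ) ≤ s * Fintype.card A * N * T := by
      have h5 : (1 : ℝ) ≤ N * T := one_le_mul_of_one_le_of_one_le hN1 hT1
      have h6 : (4 : ℝ) ≤ s * Fintype.card A := by nlinarith
      nlinarith
    have h7 : (4 : ℝ) ≤ s * Fintype.card A * N * T / δ := by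
      rw [le_div_iff₀ h0]; nlinarith
    have := Real.exp_one_lt_d9
    linarith
  set a := (s : ℝ) * Λ with ha
  have ha0 : 2 ≤ a := by nlinarith
  have hC : bonusConst X A N T δ = √(2 * a) := by
    rw [bonusConst, ← hs, ← hΛ, ha, mul_assoc]
  set sg : (X → Bool) → X → ℝ := fun b x => if b x then 1 else -1 with hsg
  -- The last index guesses the visit count `m`, so that the rate `√(2 * a / m)` is deterministic in
  -- each event.
  set E : Fin N × (X × A) × (X → Bool) × Fin T × Fin T → Set Ω := fun j =>
    {ω | Real.exp a ≤ Real.exp (√(2 * a / (j.2.2.2.2 : ℕ)) * ∑ x, sg j.2.2.1 x *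
      (transitions (fun s => traj s ω) j.2.2.2.1 j.1 j.2.1 x -
        visits (fun s => traj s ω) j.2.2.2.1 j.1.castSucc j.2.1 * p j.1 j.2.1 x)
      - √(2 * a / (j.2.2.2.2 : ℕ)) ^ 2 / 2 *
        visits (fun s => traj s ω) j.2.2.2.1 j.1.castSucc j.2.1)} with hE
  refine ⟨⋃ j, E j, ?_, fun ω hω t ht i y => ?_⟩
  · refine (measureReal_iUnion_fintype_le E).trans ?_
    have : ∀ j, P.real (E j) ≤ Real.exp (-a) := fun j =>
      measureReal_transition_deviation_le hp hρ hobs j.1 j.2.1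
        (fun x => by simp only [hsg]; split_ifs <;> norm_num) _ _ j.2.2.2.1.2.le
    refine (sum_le_sum fun j _ => this j).trans ?_
    rw [sum_const, nsmul_eq_mul, card_univ]
    have hcard : (Fintype.card (Fin N × (X × A) × (X → Bool) × Fin T × Fin T) : ℝ) =
        N * (s * Fintype.card A * (2 ^ s * (T * T))) := by
      simp [Fintype.card_prod, ← hs]
    rw [hcard]
    exact union_bound_numeric hX2 (by linarith) hN1 hT1 h0 h1
  · by_cases hv : visits (fun s => traj s ω) t i.castSucc y = 0
    · refine (l1_sub_le_two (hp i y) (isKernel_empKernel _ t i y)).trans ?_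
      rw [bonus, hv, hC]
      simp only [Nat.cast_zero, max_eq_left (zero_le_one' ℝ), Real.sqrt_one, div_one]
      exact Real.le_sqrt_of_sq_le (by linarith)
    · set m := visits (fun s => traj s ω) t i.castSucc y with hm
      have hmT : m < T := (visits_le _ _ _ _).trans_lt ht
      have hm1 : (1 : ℝ) ≤ m := by exact_mod_cast Nat.one_le_iff_ne_zero.2 hv
      have hbon : bonus T δ (fun s => traj s ω) t i.castSucc y = √(2 * a / m) := by
        rw [bonus, ← hm, max_eq_right hm1, hC, Real.sqrt_div (by linarith)]
      set c := √(2 * a / m) with hc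
      have hc0 : 0 < c := Real.sqrt_pos.2 (by positivity)
      have hc2 : c ^ 2 * m = 2 * a := by
        rw [hc, Real.sq_sqrt (by positivity)]; field_simp
      rw [hbon, l1_sub_comm]
      refine l1_le_of_signs fun b => ?_
      have hωj : ω ∉ E (i, y, b, ⟨t, ht⟩, ⟨m, hmT⟩) := fun h => hω (Set.mem_iUnion.2 ⟨_, h⟩)
      simp only [hE, Set.mem_ofPred_eq, not_le, Real.exp_lt_exp, ← hm, ← hc] at hωj
      have hU : ∑ x, sg b x * ((transitions (fun s => traj s ω) t i y x : ℝ) - m * p i y x) =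
          m * ∑ x, sg b x * (empKernel (fun s => traj s ω) t i y - p i y) x := by
        rw [mul_sum]
        refine sum_congr rfl fun x _ => ?_
        rw [Pi.sub_apply, empKernel_of_pos hv, ← hm]
        field_simp
      rw [hU] at hωj
      show ∑ x, sg b x * (empKernel (fun s => traj s ω) t i y - p i y) x ≤ c
      -- A sum above `c` would make the exponent exceed `c ^ 2 * m - c ^ 2 * m / 2 = a`.
      by_contra hcon
      push Not at hcon
      have : c * (m * c) < c * (m * ∑ x, sg b x * (empKernel (fun s => traj s ω) t i y - p i y) x) :=
        mul_lt_mul_of_pos_left (mul_lt_mul_of_pos_left hcon (by linarith)) hc0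
      nlinarith

/-! ### The event comparing expected and observed bonuses. -/

lemma measurable_visits {m : MeasurableSpace Ω} {t : ℕ}
    (h : ∀ s < t, ∀ τ, MeasurableSet[m] {ω | traj s ω = τ}) (n : Fin (N + 1)) (y : X × A) :
    Measurable[m] fun ω => visits (fun s => traj s ω) t n y := by
  classical
  induction t with
  | zero => simp [visits]
  | succ t ih =>
    simp only [visits_succ]
    refine (ih fun s hs => h s (by omega)).add (Measurable.ite ?_ measurable_const measurable_const)
    have : {ω | traj t ω n = y} = ⋃ τ ∈ {τ : Fin (N + 1) → X × A | τ n = y}, {ω | traj t ω = τ} := by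
      ext ω; simp
    rw [this]
    exact MeasurableSet.biUnion (Set.to_countable _) fun τ _ => h t (by omega) τ

lemma measurable_occ {m : MeasurableSpace Ω} (p : Fin N → X × A → X → ℝ)
    {π : Ω → Fin N → X → A → ℝ} {ν : Ω → X × A → ℝ} (hπ : Measurable[m] π)
    (hν : ∀ z, Measurable[m] fun ω => ν ω z) (n : Fin (N + 1)) (z : X × A) :
    Measurable[m] fun ω => occ p (π ω) (ν ω) n z := by
  induction n using Fin.induction generalizing z with
  | zero => exact hν z
  | succ i ih =>
    simp only [occ_succ]
    refine (Finset.measurable_sum _ fun y _ => (ih y).mul_const _).mul ?_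
    exact (measurable_pi_apply z.2).comp ((measurable_pi_apply z.1).comp
      ((measurable_pi_apply i).comp hπ))

lemma measurable_initDist {m : MeasurableSpace Ω} (p : Fin N → X × A → X → ℝ) (ρ : X × A → ℝ)
    {t : ℕ} (h : ∀ s < t, Measurable[m] (pol s)) (z : X × A) :
    Measurable[m] fun ω => initDist p ρ (fun s => pol s ω) t z := by
  induction t generalizing z with
  | zero => exact measurable_const
  | succ t ih =>
    exact measurable_occ p (h t (by omega)) (fun z => ih (fun s hs => h s (by omega)) z)
      (Fin.last N) z

/-- With high probability, the expected inverse square roots of the visit counts are comparable to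
the observed ones. -/
lemma exists_bonus_event (hp : IsKernel p) (hρ : ρ ∈ stdSimplex ℝ (X × A))
    (hobs : IsObservation P ℱ T p ρ traj pol) (hN : 1 ≤ N) (h0 : 0 < δ) :
    ∃ B : Set Ω, P.real B ≤ δ ∧ ∀ ω ∉ B,
      ∑ t ∈ range T, ∑ i : Fin N, ∑ y,
        occ p (pol t ω) (initDist p ρ (fun s => pol s ω) t) i.castSucc y *
          (1 / √(max 1 (visits (fun s => traj s ω) t i.castSucc y : ℝ))) ≤
      2 * N * (3 * √((Fintype.card X : ℝ) * Fintype.card A * T) + Real.log (1 / δ)) := by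
  have hN1 : (1 : ℝ) ≤ N := by exact_mod_cast hN
  set r : ℕ → Ω → Fin N → X × A → ℝ := fun t ω i y =>
    1 / √(max 1 (visits (fun s => traj s ω) t i.castSucc y : ℝ)) with hr
  have hr0 : ∀ t ω i y, 0 ≤ r t ω i y := fun t ω i y => by positivity
  have hr1 : ∀ t ω i y, r t ω i y ≤ 1 := fun t ω i y => by
    refine (div_le_one (by positivity)).2 (Real.one_le_sqrt.2 (le_max_left _ _))
  set M : ℕ → Ω → ℝ := fun t ω => ∑ i : Fin N, ∑ y,
    occ p (pol t ω) (initDist p ρ (fun s => pol s ω) t) i.castSucc y * r t ω i y with hM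
  set φ : ℕ → Ω → (Fin (N + 1) → X × A) → ℝ := fun t ω τ => ∑ i : Fin N, r t ω i (τ i.castSucc)
  have hφ0 : ∀ t ω τ, 0 ≤ φ t ω τ := fun t ω τ => sum_nonneg fun i _ => hr0 _ _ _ _
  have hφN : ∀ t ω τ, φ t ω τ ≤ N := fun t ω τ =>
    (sum_le_sum fun i _ => hr1 _ _ _ _).trans (by simp)
  have hMφ : ∀ t < T, ∀ ω, ∑ τ, pathProb p (pol t ω) (initDist p ρ (fun s => pol s ω) t) τ *
      φ t ω τ = M t ω := by
    intro t ht ω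
    simp only [φ, mul_sum]
    rw [sum_comm]
    refine sum_congr rfl fun i _ => ?_
    rw [sum_pathProb_transition hp (hobs.isPolicy t ht ω) _ i (fun y _ => r t ω i y)]
    simp only [← sum_mul, (hp i _).2, one_mul]
  have hν : ∀ t < T, ∀ ω, initDist p ρ (fun s => pol s ω) t ∈ stdSimplex ℝ (X × A) :=
    fun t ht ω => initDist_mem hp hρ (fun s hs => hobs.isPolicy s hs ω) ht.le
  have hq1 : ∀ t < T, ∀ ω,
      ∑ τ, pathProb p (pol t ω) (initDist p ρ (fun s => pol s ω) t) τ = 1 := fun t ht ω => by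
    rw [sum_pathProb hp (hobs.isPolicy t ht ω), (hν t ht ω).2]
  have hq0 : ∀ t < T, ∀ ω τ, 0 ≤ pathProb p (pol t ω) (initDist p ρ (fun s => pol s ω) t) τ :=
    fun t ht ω τ => pathProb_nonneg hp (hobs.isPolicy t ht ω) (hν t ht ω) τ
  have hMN : ∀ t < T, ∀ ω, M t ω ≤ N := by
    intro t ht ω
    rw [← hMφ t ht ω]
    refine (sum_le_sum fun τ _ => mul_le_mul_of_nonneg_left (hφN t ω τ) (hq0 t ht ω τ)).trans ?_
    rw [← sum_mul, hq1 t ht ω, one_mul]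
  -- A multiplicative comparison: `M t` is the conditional mean of `φ t`, which lies in `[0, N]`.
  -- Halving the mean makes the conditional expectation of the weight at most 1, at the price of a
  -- factor 2 and a logarithm.
  set W : ℕ → Ω → (Fin (N + 1) → X × A) → ℝ := fun t ω τ =>
    Real.exp (M t ω / (2 * N) - φ t ω τ / N) with hW
  have hvis : ∀ t < T, ∀ i y, Measurable[ℱ t] fun ω => r t ω i y := by
    intro t ht i y
    have h1 : Measurable[ℱ t] fun ω => visits (fun s => traj s ω) t i.castSucc y :=
      measurable_visits (fun s hs τ => ℱ.mono hs _ (hobs.measurable_traj s (hs.trans ht) τ)) _ _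
    exact (measurable_of_countable fun k : ℕ => 1 / √(max 1 (k : ℝ))).comp h1
  have h := measureReal_prod_ge_le (P := P) (ℱ := ℱ) (W := W) (T := T) (B := Real.exp 1)
    hobs.measurable_traj hobs.condLaw ?_ (fun _ _ _ => (Real.exp_pos _).le) ?_ ?_ le_rfl
    (Real.log (1 / δ))
  · refine ⟨_, h.trans (le_of_eq ?_), fun ω hω => ?_⟩
    · rw [← Real.log_inv, one_div, inv_inv, Real.exp_log h0]
    · simp only [hW, Set.mem_ofPred_eq, ← Real.exp_sum, Real.exp_le_exp, not_le, sum_sub_distrib,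
        ← sum_div] at hω
      have h2 : ∑ t ∈ range T, φ t ω (traj t ω) ≤
          N * (3 * √((Fintype.card X : ℝ) * Fintype.card A * T)) := by
        simp only [φ, r]
        rw [sum_comm]
        refine (sum_le_sum fun i _ => sum_inv_sqrt_visits_le (fun s => traj s ω) T i.castSucc).trans
          (le_of_eq (by simp))
      have h3 : ∑ t ∈ range T, M t ω < 2 * (N * Real.log (1 / δ) +
          ∑ t ∈ range T, φ t ω (traj t ω)) := by
        have : (0 : ℝ) < N := by linarith
        have e : (∑ t ∈ range T, M t ω) / (2 * N) - (∑ t ∈ range T, φ t ω (traj t ω)) / N =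
          (∑ t ∈ range T, M t ω - 2 * ∑ t ∈ range T, φ t ω (traj t ω)) / (2 * N) := by
          field_simp
        rw [e, div_lt_iff₀ (by positivity)] at hω
        linarith
      show ∑ t ∈ range T, M t ω ≤ _
      linarith
  · intro t ht τ
    refine Real.measurable_exp.comp (Measurable.sub (Measurable.div_const ?_ _)
      (Measurable.div_const ?_ _))
    · refine Finset.measurable_sum _ fun i _ => Finset.measurable_sum _ fun y _ =>
        Measurable.mul ?_ (hvis t ht i y)
      exact measurable_occ p (hobs.measurable_pol t ht) (measurable_initDist p ρ fun s hs =>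
        (hobs.measurable_pol s (hs.trans ht)).mono (ℱ.mono hs.le) le_rfl) _ _
    · exact Finset.measurable_sum _ fun i _ => hvis t ht i _
  · intro t ht ω τ
    refine Real.exp_le_exp.2 ?_
    have h1 : M t ω / (2 * N) ≤ 1 := by
      rw [div_le_one (by linarith)]; linarith [hMN t ht ω]
    have h2 : 0 ≤ φ t ω τ / N := div_nonneg (hφ0 _ _ _) (by linarith)
    linarith
  · intro t ht ω
    -- Applied to `x = φ / N`, this bounds the mean of `exp (-x)` by `1 - M / (2 * N) ≤ exp (-M / (2
    -- * N))`.
    have hx : ∀ x : ℝ, 0 ≤ x → x ≤ 1 → Real.exp (-x) ≤ 1 - x / 2 := by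
      intro x hx0 hx1
      have h2 := Real.quadratic_le_exp_of_nonneg hx0
      rw [Real.exp_neg, inv_le_comm₀ (Real.exp_pos x) (by linarith)]
      refine le_trans ?_ h2
      rw [inv_le_iff_one_le_mul₀ (by linarith)]
      nlinarith [mul_nonneg hx0 (sub_nonneg.2 hx1), mul_nonneg (mul_nonneg hx0 hx0) hx0,
        mul_nonneg (mul_nonneg hx0 hx0) (sub_nonneg.2 hx1)]
    have h1 : ∀ τ, W t ω τ ≤ Real.exp (M t ω / (2 * N)) * (1 - φ t ω τ * (1 / (2 * N))) := by
      intro τ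
      simp only [hW]
      rw [sub_eq_add_neg, Real.exp_add]
      refine mul_le_mul_of_nonneg_left ?_ (Real.exp_pos _).le
      refine (hx (φ t ω τ / N) (div_nonneg (hφ0 _ _ _) (by linarith))
        (div_le_one_of_le₀ (hφN _ _ _) (by linarith))).trans (le_of_eq ?_)
      field_simp
    refine (sum_le_sum fun τ _ => mul_le_mul_of_nonneg_left (h1 τ) (hq0 t ht ω τ)).trans ?_
    have e : ∀ τ, pathProb p (pol t ω) (initDist p ρ (fun s => pol s ω) t) τ *
        (Real.exp (M t ω / (2 * N)) * (1 - φ t ω τ * (1 / (2 * N)))) =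
        Real.exp (M t ω / (2 * N)) *
          (pathProb p (pol t ω) (initDist p ρ (fun s => pol s ω) t) τ -
          pathProb p (pol t ω) (initDist p ρ (fun s => pol s ω) t) τ * φ t ω τ *
            (1 / (2 * N))) := fun τ => by ring
    simp only [e]
    rw [← mul_sum, sum_sub_distrib, ← sum_mul, hMφ t ht ω, hq1 t ht ω]
    have h2 := Real.add_one_le_exp (-(M t ω / (2 * N)))
    have h3 : 1 - M t ω * (1 / (2 * N)) ≤ Real.exp (-(M t ω / (2 * N))) := by
      refine le_trans (le_of_eq ?_) h2; ring
    refine (mul_le_mul_of_nonneg_left h3 (Real.exp_pos _).le).trans (le_of_eq ?_)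
    rw [← Real.exp_add, add_neg_cancel, Real.exp_zero]

end Concentration

/-! ### Ingredients of the mirror-descent analysis. -/

section Regret

variable {X A : Type*} [Fintype X] [Fintype A] {N T : ℕ} {δ ℓ α η Ψ : ℝ}

/-- Iterate and comparator share kernel and initial distribution, so they agree at step 0 and have
equal masses; for `gamma`, positivity of `π'` gives the domination of supports. -/
lemma occ_first_order {D : Div} {p : Fin N → X × A → X → ℝ} {π π' πc : Fin N → X → A → ℝ}
    {ν : X × A → ℝ} {μ : Fin (N + 1) → X × A → ℝ} {C : Set (Fin (N + 1) → X × A → ℝ)}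
    {z : Fin N → X × A → ℝ} (hp : IsKernel p) (hπ' : IsPolicy π') (hπc : IsPolicy πc)
    (hν : ν ∈ stdSimplex ℝ (X × A)) (hC : Convex ℝ C) (h1 : occ p π' ν ∈ C) (h2 : occ p πc ν ∈ C)
    (hmin : IsMinOn (fun μ' => η * pairing z μ' + D.val μ' μ π) C (occ p π' ν))
    (hr : D.Regular μ π) (hr' : D.Regular (occ p π' ν) π') :
    0 ≤ η * pairing z (occ p πc ν - occ p π' ν) +
      pairing (D.grad (occ p π' ν) π' - D.grad μ π) (occ p πc ν - occ p π' ν) := by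
  cases D with
  | kl =>
    refine kl_first_order hC h1 h2 hmin rfl (fun n => ?_) hr' hr
    rw [(occ_mem hp hπc hν n).2, (occ_mem hp hπ' hν n).2]
  | gamma =>
    refine gamma_first_order hC h1 h2 hmin rfl (fun n => (occ_mem hp hπ' hν n).1)
      (fun i x a => ?_) (fun i y hy => occ_eq_zero hp hπ' hr' hν hy) hr' hr
    rw [sum_occ_succ hπ', occ_succ]

/-- For `kl` the pairing is the sum of the entropies of the marginals, as the constants of the
gradients cancel. For `gamma` it is the entropy of the policies along the new trajectory, which
compares them inside the new model only; passing to the old model costs `d`. -/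
lemma l1_sub_le_of_grad {D : Div} {p p' : Fin N → X × A → X → ℝ} {π π' : Fin N → X → A → ℝ}
    {ν ν' : X × A → ℝ} (hp : IsKernel p) (hp' : IsKernel p') (hπ : IsPolicy π) (hπ' : IsPolicy π')
    (hν : ν ∈ stdSimplex ℝ (X × A)) (hν' : ν' ∈ stdSimplex ℝ (X × A))
    (hr : D.Regular (occ p π ν) π) (hr' : D.Regular (occ p' π' ν') π') {d : ℝ}
    (hd : ∀ n, l1 (occ p' π ν' n - occ p π ν n) ≤ d) (hd0 : 0 ≤ d) :
    0 ≤ pairing (D.grad (occ p' π' ν') π' - D.grad (occ p π ν) π) (occ p' π' ν') ∧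
    ∀ i : Fin N, l1 (occ p' π' ν' i.succ - occ p π ν i.succ) ≤
      2 * √(pairing (D.grad (occ p' π' ν') π' - D.grad (occ p π ν) π) (occ p' π' ν')) + d := by
  have hsq : ∀ {u K : ℝ}, 0 ≤ u → u ^ 2 ≤ 4 * K → u ≤ 2 * √K := fun {u K} hu h => by
    have h4 : √(4 * K) = 2 * √K := by
      rw [Real.sqrt_mul (by norm_num), show (4 : ℝ) = 2 ^ 2 by norm_num,
        Real.sqrt_sq (by norm_num)]
    exact h4 ▸ Real.le_sqrt_of_sq_le h
  cases D with
  | kl =>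
    set K := pairing (Div.kl.grad (occ p' π' ν') π' - Div.kl.grad (occ p π ν) π) (occ p' π' ν')
      with hK
    have hKe : K = ∑ i : Fin N, relEnt (occ p' π' ν' i.succ) (occ p π ν i.succ) := by
      simp only [hK, pairing, relEnt, Div.grad, Pi.sub_apply]
      exact sum_congr rfl fun i _ => sum_congr rfl fun y _ => by ring
    have hnn : ∀ i : Fin N, 0 ≤ relEnt (occ p' π' ν' i.succ) (occ p π ν i.succ) := fun i =>
      relEnt_nonneg (occ_mem hp' hπ' hν' _) (occ_mem hp hπ hν _)
        fun y hy => absurd hy (hr i y).ne'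
    refine ⟨hKe ▸ sum_nonneg fun i _ => hnn i, fun i => ?_⟩
    have h1 : relEnt (occ p' π' ν' i.succ) (occ p π ν i.succ) ≤ K :=
      hKe ▸ single_le_sum (f := fun i : Fin N => relEnt (occ p' π' ν' i.succ) (occ p π ν i.succ))
        (fun i _ => hnn i) (mem_univ i)
    have h2 := sq_l1_sub_le_relEnt (occ_mem hp' hπ' hν' i.succ) (occ_mem hp hπ hν i.succ)
      fun y hy => absurd hy (hr i y).ne'
    have := hsq (l1_nonneg _) (h2.trans (by linarith : _ ≤ 4 * K))
    linarith
  | gamma =>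
    have h1 := relEnt_occ_le hp' hπ' hπ hr' hr hν'
    have hac : ∀ n y, occ p' π ν' n y = 0 → occ p' π' ν' n y = 0 := fun n y h =>
      occ_eq_zero hp' hπ hr hν' h
    refine ⟨(relEnt_nonneg (occ_mem hp' hπ' hν' 0) (occ_mem hp' hπ hν' 0) (hac 0)).trans (h1 0),
      fun i => ?_⟩
    have h2 := sq_l1_sub_le_relEnt (occ_mem hp' hπ' hν' i.succ) (occ_mem hp' hπ hν' i.succ)
      (hac i.succ)
    have h3 := hsq (l1_nonneg _) (h2.trans (mul_le_mul_of_nonneg_left (h1 i.succ) (by norm_num)))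
    exact (l1_sub_le _ (occ p' π ν' i.succ) _).trans (add_le_add h3 (hd i.succ))

lemma abs_subgradient_le {f : (X × A → ℝ) → ℝ} {u g : X × A → ℝ}
    (hf : ∀ u v, |f u - f v| ≤ ℓ * l1 (u - v)) (hg : IsSubgradient f u g) (y : X × A) :
    |g y| ≤ ℓ := by
  classical
  have key : ∀ c : ℝ, |c| = 1 → g y * c ≤ ℓ := by
    intro c hc
    have h1 := hg (u + Pi.single y c)
    have h2 := (le_abs_self _).trans (hf (u + Pi.single y c) u)
    have h3 : l1 (u + Pi.single y c - u) = 1 := by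
      rw [add_sub_cancel_left, l1, sum_eq_single y]
      · simp [hc]
      · intro b _ hb; simp [hb]
      · simp
    have h4 : ∑ y', g y' * ((u + Pi.single y c : X × A → ℝ) y' - u y') = g y * c := by
      rw [sum_eq_single y]
      · simp
      · intro b _ hb; simp [hb]
      · simp
    rw [h3, mul_one] at h2
    rw [h4] at h1
    linarith
  have h1 := key 1 (by simp)
  have h2 := key (-1) (by simp)
  exact abs_le.2 ⟨by linarith, by linarith⟩

/-- The pairing starts at step 1, so the loss bonus is at most `ℓ (N - 1) C`; the missing `ℓ C`
covers the subgradient. -/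
lemma abs_mdVec_le {h : ℕ → Fin (N + 1) → X × A} {g : Fin N → X × A → ℝ} (hℓ : 0 ≤ ℓ)
    (hC : 1 ≤ bonusConst X A N T δ) (hg : ∀ i y, |g i y| ≤ ℓ) (t : ℕ) (i : Fin N) (y : X × A) :
    |mdVec T δ ℓ h g t i y| ≤ ℓ * (N * bonusConst X A N T δ) := by
  set C := bonusConst X A N T δ
  have hiN : ((i : ℕ) : ℝ) + 1 ≤ N := by exact_mod_cast i.2
  have hi0 : (0 : ℝ) ≤ (i : ℕ) := Nat.cast_nonneg _
  have h1 : (1 : ℝ) ≤ √(max 1 (visits h t i.succ y : ℝ)) := Real.one_le_sqrt.2 (le_max_left _ _)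
  have hb0 : 0 ≤ ℓ * ((N : ℝ) - (i.succ : ℕ)) * C := by
    have : (0 : ℝ) ≤ (N : ℝ) - (i.succ : ℕ) := by simp; linarith
    positivity
  have hb : |lossBonus T δ ℓ h t i.succ y| ≤ ℓ * ((N - 1) * C) := by
    rw [lossBonus, abs_of_nonneg (div_nonneg hb0 (by positivity))]
    refine (div_le_self hb0 h1).trans ?_
    rw [mul_assoc]
    refine mul_le_mul_of_nonneg_left (mul_le_mul_of_nonneg_right ?_ (by linarith)) hℓ
    simp
  refine (abs_sub _ _).trans ((add_le_add (hg i y) hb).trans ?_)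
  have : ℓ * 1 ≤ ℓ * C := mul_le_mul_of_nonneg_left hC hℓ
  linarith

/-- The gradient of the divergence is bounded away from zero when there are two actions. -/
lemma le_norm1inf_grad {D : Div} {p : Fin N → X × A → X → ℝ} {π : Fin N → X → A → ℝ}
    {ν : X × A → ℝ} [Nonempty X] (hp : IsKernel p) (hπ : IsPolicy π)
    (hν : ν ∈ stdSimplex ℝ (X × A)) (hA : 2 ≤ Fintype.card A) (hN : 1 ≤ N)
    (hr : D.Regular (occ p π ν) π) : 1 / 16 ≤ norm1inf (D.grad (occ p π ν) π) := by
  have hnn : ∀ i : Fin N, 0 ≤ ⨆ y, |D.grad (occ p π ν) π i y| := fun i =>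
    Real.iSup_nonneg fun _ => abs_nonneg _
  set i0 : Fin N := ⟨0, hN⟩
  refine le_trans ?_ (single_le_sum (f := fun i => ⨆ y, |D.grad (occ p π ν) π i y|)
    (fun i _ => hnn i) (mem_univ i0))
  by_contra hcon
  push Not at hcon
  have hlt : ∀ y, |D.grad (occ p π ν) π i0 y| < 1 / 16 := fun y =>
    (le_ciSup (f := fun y => |D.grad (occ p π ν) π i0 y|)
      (Set.finite_range _).bddAbove y).trans_lt hcon
  have hX : 1 ≤ Fintype.card X := Fintype.card_pos
  -- For `kl`, a small gradient puts every mass near `1 / e`, strictly between `1/3` and `1/2`, so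
  -- the masses cannot sum to 1. For `gamma`, every action would have probability at least `15 /
  -- 16`.
  cases D with
  | kl =>
    set w := occ p π ν i0.succ with hw
    have hwm : w ∈ stdSimplex ℝ (X × A) := occ_mem hp hπ hν _
    have he := Real.exp_one_lt_d9
    have he' := Real.exp_one_gt_d9
    have hlo : ∀ y, 67 / 200 < w y := by
      intro y
      have h1 : Real.log (w y) + 1 > -(1 / 16) := (abs_lt.1 (hlt y)).1
      have h2 : Real.exp (-(17 / 16)) < w y := by
        rw [← Real.lt_log_iff_exp_lt (hr i0 y)]; linarith
      refine lt_trans ?_ h2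
      have h3 : Real.exp (-(17 / 16)) = (Real.exp 1)⁻¹ * Real.exp (-(1 / 16)) := by
        rw [← Real.exp_neg, ← Real.exp_add]; norm_num
      have h4 := Real.add_one_le_exp (-(1 / 16 : ℝ))
      rw [h3]
      have h5 : 36 / 100 < (Real.exp 1)⁻¹ := by
        rw [lt_inv_comm₀ (by norm_num) (Real.exp_pos 1)]; norm_num; linarith
      nlinarith
    have hhi : ∀ y, w y < 2 / 5 := by
      intro y
      have h1 : Real.log (w y) + 1 < 1 / 16 := (abs_lt.1 (hlt y)).2
      have h2 : w y < Real.exp (-(15 / 16)) := by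
        rw [← Real.log_lt_iff_lt_exp (hr i0 y)]; linarith
      refine h2.trans ?_
      have h3 : Real.exp (-(15 / 16)) = (Real.exp 1)⁻¹ * (Real.exp (-(1 / 16)))⁻¹ := by
        rw [← Real.exp_neg, ← Real.exp_neg, ← Real.exp_add]; norm_num
      have h4 := Real.add_one_le_exp (-(1 / 16 : ℝ))
      have h5 : (Real.exp (-(1 / 16)))⁻¹ ≤ 16 / 15 := by
        rw [inv_le_comm₀ (Real.exp_pos _) (by norm_num)]; norm_num; norm_num at h4; linarith
      have h6 : (Real.exp 1)⁻¹ < 37 / 100 := by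
        rw [inv_lt_comm₀ (Real.exp_pos 1) (by norm_num)]; norm_num; linarith
      rw [h3]
      have := Real.exp_pos (-(1 / 16 : ℝ))
      have h7 : 0 < (Real.exp (-(1 / 16)))⁻¹ := by positivity
      nlinarith
    have hc : 2 ≤ Fintype.card (X × A) := by
      rw [Fintype.card_prod]; nlinarith
    have hs := hwm.2
    rcases hc.eq_or_lt with hc2 | hc3
    · have : ∑ y, w y ≤ ∑ _y : X × A, (2 / 5 : ℝ) := sum_le_sum fun y _ => (hhi y).le
      rw [hs, sum_const, card_univ, ← hc2] at this
      norm_num at this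
    · have : ∑ _y : X × A, (67 / 200 : ℝ) ≤ ∑ y, w y := sum_le_sum fun y _ => (hlo y).le
      rw [hs, sum_const, card_univ, nsmul_eq_mul] at this
      have h3 : (3 : ℝ) ≤ Fintype.card (X × A) := by exact_mod_cast hc3
      linarith
  | gamma =>
    obtain ⟨x⟩ := ‹Nonempty X›
    have hlo : ∀ a, 15 / 16 ≤ π i0 x a := by
      intro a
      have h1 : -(1 / 16) < Real.log (π i0 x a) := (abs_lt.1 (hlt (x, a))).1
      have h2 : Real.log (π i0 x a) ≤ π i0 x a - 1 := Real.log_le_sub_one_of_pos (hr i0 x a)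
      linarith
    have : ∑ _a : A, (15 / 16 : ℝ) ≤ ∑ a, π i0 x a := sum_le_sum fun a _ => hlo a
    rw [(hπ i0 x).2, sum_const, card_univ, nsmul_eq_mul] at this
    have h2 : (2 : ℝ) ≤ Fintype.card A := by exact_mod_cast hA
    linarith

/-- Summing the recursion gives the geometric factor. It starts at `t = 1` because the first policy
is arbitrary and satisfies no constraint; `r 1 ≤ 2` covers that episode. -/
lemma sum_contraction_le {r m : ℕ → ℝ} (hr : ∀ t, 0 ≤ r t) (hm : ∀ t, 0 ≤ m t) (hα : 0 ≤ α)
    (h0 : r 0 = 0) (h1 : r 1 ≤ 2) {n : ℕ}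
    (h : ∀ t, 1 ≤ t → t < n → r (t + 1) ≤ α * r t + m t) :
    (1 - α) * ∑ t ∈ range (n + 1), r t ≤ 2 + ∑ t ∈ range n, m t := by
  have key : ∑ t ∈ range (n + 1), r t ≤ α * ∑ t ∈ range n, r t + (2 + ∑ t ∈ range n, m t) := by
    induction n with
    | zero => simp [h0]
    | succ n ih =>
      rcases Nat.eq_zero_or_pos n with rfl | hn
      · have := hm 0
        simp [sum_range_succ, h0]
        linarith
      · have h2 := ih fun t ht htn => h t ht (by omega)
        have h3 := h n hn (by omega)
        rw [sum_range_succ, sum_range_succ m, sum_range_succ r n, mul_add]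
        rw [sum_range_succ] at h2
        linarith
  have h2 : α * ∑ t ∈ range n, r t ≤ α * ∑ t ∈ range (n + 1), r t := by
    rw [sum_range_succ]
    have := mul_nonneg hα (hr n)
    linarith
  linarith

end Regret

/-! ### Feasibility, drift, and regret for a given realization. -/

section RegretBound

variable {X A : Type*} [Fintype X] [Fintype A] {N T : ℕ} {δ ℓ α η Ψ : ℝ}

/-- The inverse square root of the visit counts. -/
noncomputable def invSqrtVisits (h : ℕ → Fin (N + 1) → X × A) (t : ℕ) (n : Fin (N + 1))
    (y : X × A) : ℝ :=
  1 / √(max 1 (visits h t n y : ℝ))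

lemma invSqrtVisits_nonneg (h : ℕ → Fin (N + 1) → X × A) (t : ℕ) (n : Fin (N + 1)) (y : X × A) :
    0 ≤ invSqrtVisits h t n y := by
  unfold invSqrtVisits; positivity

lemma invSqrtVisits_le_one (h : ℕ → Fin (N + 1) → X × A) (t : ℕ) (n : Fin (N + 1)) (y : X × A) :
    invSqrtVisits h t n y ≤ 1 :=
  (div_le_one (by positivity)).2 (Real.one_le_sqrt.2 (le_max_left _ _))

lemma bonus_eq (h : ℕ → Fin (N + 1) → X × A) (t : ℕ) (n : Fin (N + 1)) (y : X × A) :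
    bonus T δ h t n y = bonusConst X A N T δ * invSqrtVisits h t n y := by
  rw [bonus, invSqrtVisits]; ring

/-- The expected sum of the inverse square roots of the visit counts in one episode. -/
noncomputable def expInvSqrt (p : Fin N → X × A → X → ℝ) (h : ℕ → Fin (N + 1) → X × A) (t : ℕ)
    (π : Fin N → X → A → ℝ) (ν : X × A → ℝ) : ℝ :=
  ∑ i : Fin N, ∑ y, occ p π ν i.castSucc y * invSqrtVisits h t i.castSucc y

/-- Bound on the change of the induced distributions between the episodes `t` and `t + 1`. -/
noncomputable def drift (p : Fin N → X × A → X → ℝ) (ρ : X × A → ℝ) (h : ℕ → Fin (N + 1) → X × A)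
    (pol : ℕ → Fin N → X → A → ℝ) (t : ℕ) : ℝ :=
  l1 (initDist p ρ pol (t + 1) - initDist p ρ pol t) +
    ∑ i : Fin N, 2 * invSqrtVisits h t i.castSucc (h t i.castSucc)

variable {p : Fin N → X × A → X → ℝ} {ρ ν : X × A → ℝ} {h : ℕ → Fin (N + 1) → X × A}
  {pol : ℕ → Fin N → X → A → ℝ} {π : Fin N → X → A → ℝ} {t : ℕ} {D : Div}
  {g : ℕ → Fin N → X × A → ℝ}

lemma drift_nonneg (p : Fin N → X × A → X → ℝ) (ρ : X × A → ℝ) (h : ℕ → Fin (N + 1) → X × A)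
    (pol : ℕ → Fin N → X → A → ℝ) (t : ℕ) : 0 ≤ drift p ρ h pol t :=
  add_nonneg (l1_nonneg _) (sum_nonneg fun _ _ =>
    mul_nonneg zero_le_two (invSqrtVisits_nonneg _ _ _ _))

/-- The distributions induced by a periodic policy in the estimated model are feasible. -/
lemma occ_mem_constraintSet [Nonempty X] (hp : IsKernel p) (hρ : ρ ∈ stdSimplex ℝ (X × A))
    (hcon : Contracts p ρ α) (hπ : IsPeriodic p ρ π) (hν : ν ∈ stdSimplex ℝ (X × A))
    (hK : ∀ i y, l1 (p i y - empKernel h t i y) ≤ bonus T δ h t i.castSucc y) :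
    occ (empKernel h t) π ν ∈ constraintSet T δ α ρ ν h t := by
  have hk := isKernel_empKernel h t
  refine ⟨occ_mem_flowSet hk hπ.1 hν, ?_⟩
  refine (l1_sub_le _ (terminal p π ν) _).trans (add_le_add ?_ ?_)
  · refine (l1_occ_sub_le hk hp hπ.1 hν (Fin.last N)).trans ?_
    rw [sub_self, show l1 (0 : X × A → ℝ) = 0 by simp [l1], zero_add]
    refine sum_le_sum fun i _ => sum_le_sum fun y _ => mul_le_mul_of_nonneg_left ?_
      ((occ_mem hk hπ.1 hν _).1 y)
    rw [l1_sub_comm]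
    exact hK i y
  · have := hcon π hπ ν hν ρ hρ
    rwa [hπ.2] at this

/-- One step of the distance of the initial distributions to `ρ`. -/
lemma l1_terminal_sub_le [Nonempty X] (hp : IsKernel p) (hπ : IsPolicy π)
    (hν : ν ∈ stdSimplex ℝ (X × A))
    (hK : ∀ i y, l1 (p i y - empKernel h t i y) ≤ bonus T δ h t i.castSucc y)
    (hmem : occ (empKernel h t) π ν ∈ constraintSet T δ α ρ ν h t) :
    l1 (terminal p π ν - ρ) ≤ α * l1 (ν - ρ) +
      (2 + N * bonusConst X A N T δ) * (bonusConst X A N T δ * expInvSqrt p h t π ν) := by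
  set C := bonusConst X A N T δ
  have hC0 : 0 ≤ C := Real.sqrt_nonneg _
  set B := C * expInvSqrt p h t π ν with hB
  have hBe : B = ∑ i : Fin N, ∑ y, occ p π ν i.castSucc y * bonus T δ h t i.castSucc y := by
    simp only [hB, expInvSqrt, mul_sum, bonus_eq]
    exact sum_congr rfl fun i _ => sum_congr rfl fun y _ => by ring
  have hdist : ∀ n, l1 (occ p π ν n - occ (empKernel h t) π ν n) ≤ B := by
    intro n
    refine (l1_occ_sub_le hp (isKernel_empKernel h t) hπ hν n).trans ?_
    rw [sub_self, show l1 (0 : X × A → ℝ) = 0 by simp [l1], zero_add, hBe]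
    exact sum_le_sum fun i _ => sum_le_sum fun y _ => mul_le_mul_of_nonneg_left (hK i y)
      ((occ_mem hp hπ hν _).1 y)
  have hbon : ∀ n y, |bonus T δ h t n y| ≤ C := by
    intro n y
    rw [bonus_eq, abs_of_nonneg (mul_nonneg hC0 (invSqrtVisits_nonneg _ _ _ _))]
    exact mul_le_of_le_one_right hC0 (invSqrtVisits_le_one _ _ _ _)
  -- The constraint averages the bonus under the estimated law, the concentration event under the
  -- true one; exchanging them costs `C * B` per step.
  have h1 : ∑ i : Fin N, ∑ y, occ (empKernel h t) π ν i.castSucc y * bonus T δ h t i.castSucc y ≤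
      B + N * (C * B) := by
    have : ∀ i : Fin N, ∑ y, occ (empKernel h t) π ν i.castSucc y * bonus T δ h t i.castSucc y ≤
        ∑ y, occ p π ν i.castSucc y * bonus T δ h t i.castSucc y + C * B := by
      intro i
      have h2 := (le_abs_self _).trans ((abs_sum_mul_le (bonus T δ h t i.castSucc)
        (occ (empKernel h t) π ν i.castSucc - occ p π ν i.castSucc) (hbon _)).trans
        (mul_le_mul_of_nonneg_left ((l1_sub_comm _ _).trans_le (hdist i.castSucc)) hC0))
      simp only [Pi.sub_apply, mul_sub, sum_sub_distrib] at h2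
      simp only [mul_comm (bonus T δ h t i.castSucc _)] at h2
      linarith
    refine (sum_le_sum fun i _ => this i).trans (le_of_eq ?_)
    rw [sum_add_distrib, ← hBe]
    simp
  have h2 := hmem.2
  have h3 := l1_sub_le (terminal p π ν) (occ (empKernel h t) π ν (Fin.last N)) ρ
  have h4 := hdist (Fin.last N)
  have h5 : l1 (terminal p π ν - occ (empKernel h t) π ν (Fin.last N)) ≤ B := h4
  linarith

/-- The induced distributions change by at most the drift between consecutive episodes. -/
lemma l1_occ_succ_sub_le_drift [Nonempty X] (hπ : IsPolicy π)
    (hν : initDist p ρ pol (t + 1) ∈ stdSimplex ℝ (X × A)) (n : Fin (N + 1)) :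
    l1 (occ (empKernel h (t + 1)) π (initDist p ρ pol (t + 1)) n -
      occ (empKernel h t) π (initDist p ρ pol t) n) ≤ drift p ρ h pol t := by
  have hk := isKernel_empKernel h (t + 1)
  refine (l1_occ_sub_le hk (isKernel_empKernel h t) hπ hν n).trans
    (add_le_add le_rfl (sum_le_sum fun i _ => ?_))
  refine (sum_le_sum fun y _ => mul_le_mul_of_nonneg_left (l1_empKernel_succ_sub_le h t i y)
    ((occ_mem hk hπ hν _).1 y)).trans ?_
  rw [← sum_mul, (occ_mem hk hπ hν _).2, one_mul]
  rfl

/-- Consecutive initial distributions are compared through `ρ`, so their variation is at most twice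
the sum of the distances to `ρ`; the kernel part telescopes through the visit counts. -/
lemma sum_drift_le {n : ℕ} (hp : IsKernel p) (hρ : ρ ∈ stdSimplex ℝ (X × A))
    (hpol : ∀ t < n + 1, IsPolicy (pol t)) (hα0 : 0 ≤ α) (hα1 : α < 1) {m : ℕ → ℝ}
    (hm : ∀ t, 0 ≤ m t)
    (hstep : ∀ t, 1 ≤ t → t < n →
      l1 (initDist p ρ pol (t + 1) - ρ) ≤ α * l1 (initDist p ρ pol t - ρ) + m t) :
    ∑ t ∈ range n, drift p ρ h pol t ≤ 2 * ((2 + ∑ t ∈ range n, m t) / (1 - α)) +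
      6 * N * √((Fintype.card X : ℝ) * Fintype.card A * (n + 1 : ℕ)) := by
  have h1 : ∑ t ∈ range n, ∑ i : Fin N, 2 * invSqrtVisits h t i.castSucc (h t i.castSucc) ≤
      6 * N * √((Fintype.card X : ℝ) * Fintype.card A * (n + 1 : ℕ)) := by
    rw [sum_comm]
    have : ∀ i : Fin N, ∑ t ∈ range n, 2 * invSqrtVisits h t i.castSucc (h t i.castSucc) ≤
        6 * √((Fintype.card X : ℝ) * Fintype.card A * (n + 1 : ℕ)) := by
      intro i
      have h2 := sum_inv_sqrt_visits_le h (n + 1) i.castSucc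
      rw [sum_range_succ] at h2
      have h3 : 0 ≤ 1 / √(max 1 (visits h n i.castSucc (h n i.castSucc) : ℝ)) := by positivity
      rw [← mul_sum]
      simp only [invSqrtVisits]
      linarith
    refine (sum_le_sum fun i _ => this i).trans (le_of_eq ?_)
    rw [sum_const, card_univ, Fintype.card_fin, nsmul_eq_mul]; ring
  set r : ℕ → ℝ := fun t => l1 (initDist p ρ pol t - ρ) with hr
  have hr0 : r 0 = 0 := by simp [hr, initDist, l1]
  have hr1 : r 1 ≤ 2 := l1_sub_le_two (initDist_mem hp hρ hpol (by omega)) hρ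
  have h2 := sum_contraction_le (r := r) (fun t => l1_nonneg _) hm hα0 hr0 hr1 hstep
  rw [mul_comm, ← le_div_iff₀ (by linarith)] at h2
  have h3 : ∑ t ∈ range n, l1 (initDist p ρ pol (t + 1) - initDist p ρ pol t) ≤
      2 * ∑ t ∈ range (n + 1), r t := by
    have h4 : ∀ t, l1 (initDist p ρ pol (t + 1) - initDist p ρ pol t) ≤ r (t + 1) + r t :=
      fun t => (l1_sub_le _ ρ _).trans (add_le_add le_rfl (l1_sub_comm _ _).le)
    refine (sum_le_sum fun t _ => h4 t).trans ?_
    rw [sum_add_distrib]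
    have h5 := sum_range_succ' r n
    have h6 := sum_range_succ r n
    have h7 : 0 ≤ r n := l1_nonneg _
    linarith
  simp only [drift, sum_add_distrib]
  linarith

/-- One step of mirror descent. -/
lemma pairing_step_le [Nonempty X] {πc : Fin N → X → A → ℝ} {κ : ℝ} (hp : IsKernel p)
    (hρ : ρ ∈ stdSimplex ℝ (X × A)) (hpol : ∀ t < T, IsPolicy (pol t)) (hπc : IsPolicy πc)
    (hη : 0 < η) (hκ : 0 ≤ κ) (ht : t + 1 < T)
    (hrule : FollowsRule D T δ ℓ α η p ρ h pol g)
    (hreg : ∀ t < T, D.Regular (iterate p ρ h pol t) (pol t))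
    (hfeas : occ (empKernel h (t + 1)) πc (initDist p ρ pol (t + 1)) ∈
      constraintSet T δ α ρ (initDist p ρ pol (t + 1)) h (t + 1))
    (hz : ∀ i y, |mdVec T δ ℓ h (g t) t i y| ≤ κ) :
    η * pairing (mdVec T δ ℓ h (g t) t)
        (iterate p ρ h pol t - occ (empKernel h t) πc (initDist p ρ pol t)) ≤
      pairing (D.grad (iterate p ρ h pol (t + 1)) (pol (t + 1)) -
        D.grad (iterate p ρ h pol t) (pol t))
        (occ (empKernel h (t + 1)) πc (initDist p ρ pol (t + 1))) +
      (η * (N * κ)) ^ 2 + 2 * (η * (N * κ)) * drift p ρ h pol t := by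
  obtain ⟨hin, hmin⟩ := hrule t ht (hreg t (by omega)) ⟨_, hfeas⟩
  have hν := initDist_mem hp hρ hpol (t := t) (by omega)
  have hν' := initDist_mem hp hρ hpol (t := t + 1) (by omega)
  have hk := isKernel_empKernel h t
  have hk' := isKernel_empKernel h (t + 1)
  have hπ := hpol t (by omega)
  have hπ' := hpol (t + 1) ht
  set z := mdVec T δ ℓ h (g t) t
  set d := drift p ρ h pol t
  have hd0 : 0 ≤ d := drift_nonneg _ _ _ _ _
  have hfo := occ_first_order hk' hπ' hπc hν' (convex_constraintSet T δ α ρ _ h (t + 1)) hin hfeas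
    hmin (hreg t (by omega)) (hreg (t + 1) ht)
  obtain ⟨hK0, hKl⟩ := l1_sub_le_of_grad hk hk' hπ hπ' hν hν' (hreg t (by omega)) (hreg (t + 1) ht)
    (fun n => l1_occ_succ_sub_le_drift hπ hν' n) hd0
  have h1 := (le_abs_self _).trans (abs_pairing_le z (iterate p ρ h pol t -
    iterate p ρ h pol (t + 1)) hκ hz fun i => (l1_sub_comm _ _).trans_le (hKl i))
  have h2 := (le_abs_self _).trans (abs_pairing_le z
    (occ (empKernel h (t + 1)) πc (initDist p ρ pol (t + 1)) -
      occ (empKernel h t) πc (initDist p ρ pol t)) hκ hz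
      fun i => l1_occ_succ_sub_le_drift hπc hν' i.succ)
  rw [pairing_sub] at h1 h2
  rw [show occ (empKernel h (t + 1)) (pol (t + 1)) (initDist p ρ pol (t + 1)) =
    iterate p ρ h pol (t + 1) from rfl] at *
  rw [show occ (empKernel h t) (pol t) (initDist p ρ pol t) = iterate p ρ h pol t from rfl] at *
  set G' := D.grad (iterate p ρ h pol (t + 1)) (pol (t + 1))
  set G := D.grad (iterate p ρ h pol t) (pol t)
  set K := pairing (G' - G) (iterate p ρ h pol (t + 1)) with hK
  rw [pairing_sub, pairing_sub, ← hK] at hfo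
  rw [pairing_sub]
  have hs := Real.sq_sqrt hK0
  have h1' := mul_le_mul_of_nonneg_left h1 hη.le
  have h2' := mul_le_mul_of_nonneg_left h2 hη.le
  -- This absorbs the movement of the iterate: `2 η N κ √K - K ≤ (η N κ)²`. The drift enters twice,
  -- once through the iterates and once through the comparators.
  have h3 := sq_nonneg (η * (N * κ) - √K)
  nlinarith

/-- The regret of mirror descent in terms of the total drift. -/
lemma regretMD_le [Nonempty X] {πc : Fin N → X → A → ℝ} {κ : ℝ} {n : ℕ} (hp : IsKernel p)
    (hρ : ρ ∈ stdSimplex ℝ (X × A)) (hpol : ∀ t < n + 1, IsPolicy (pol t)) (hπc : IsPolicy πc)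
    (hη : 0 < η) (hκ : 0 ≤ κ) (hrule : FollowsRule D (n + 1) δ ℓ α η p ρ h pol g)
    (hreg : ∀ t < n + 1, D.Regular (iterate p ρ h pol t) (pol t) ∧
      norm1inf (D.grad (iterate p ρ h pol t) (pol t)) ≤ Ψ)
    (hfeas : ∀ t < n + 1, occ (empKernel h t) πc (initDist p ρ pol t) ∈
      constraintSet (n + 1) δ α ρ (initDist p ρ pol t) h t)
    (hz : ∀ t < n + 1, ∀ i y, |mdVec (n + 1) δ ℓ h (g t) t i y| ≤ κ) :
    regretMD (n + 1) δ ℓ p ρ h pol g πc ≤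
      Ψ * (∑ t ∈ range n, drift p ρ h pol t + 2) / η + n * η * (N * κ) ^ 2 +
        2 * (N * κ) * (∑ t ∈ range n, drift p ρ h pol t + 1) := by
  set V := ∑ t ∈ range n, drift p ρ h pol t with hV
  have hνm : ∀ t < n + 1, initDist p ρ pol t ∈ stdSimplex ℝ (X × A) := fun t ht =>
    initDist_mem hp hρ hpol (by omega)
  set c : ℕ → Fin (N + 1) → X × A → ℝ := fun t => occ (empKernel h t) πc (initDist p ρ pol t)
  have hcm : ∀ t < n + 1, ∀ k, c t k ∈ stdSimplex ℝ (X × A) := fun t ht k =>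
    occ_mem (isKernel_empKernel h t) hπc (hνm t ht) k
  set G : ℕ → Fin N → X × A → ℝ := fun t => D.grad (iterate p ρ h pol t) (pol t) with hG
  have hΨ : 0 ≤ Ψ := (sum_nonneg fun i _ => Real.iSup_nonneg fun _ => abs_nonneg _).trans
    (hreg 0 (by omega)).2
  have hGc : ∀ t < n + 1, |pairing (G t) (c t)| ≤ Ψ := fun t ht => by
    have h1 := abs_pairing_le_norm1inf (G t) (c t) (d := 1) fun i => (l1_of_mem (hcm t ht _)).le
    exact h1.trans (by simpa using (hreg t ht).2)
  have hGd : ∀ t < n, |pairing (G t) (c (t + 1) - c t)| ≤ Ψ * drift p ρ h pol t := fun t ht => by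
    have h1 := abs_pairing_le_norm1inf (G t) (c (t + 1) - c t) (d := drift p ρ h pol t)
      fun i => l1_occ_succ_sub_le_drift hπc (hνm (t + 1) (by omega)) _
    exact h1.trans (mul_le_mul_of_nonneg_right (hreg t (by omega)).2 (drift_nonneg _ _ _ _ _))
  -- Summation by parts: the differences move from the gradients, which need not be close, to the
  -- comparators, which differ by the drift.
  have htel : ∀ k, ∑ t ∈ range k, pairing (G (t + 1) - G t) (c (t + 1)) =
      pairing (G k) (c k) - pairing (G 0) (c 0) -
        ∑ t ∈ range k, pairing (G t) (c (t + 1) - c t) := by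
    intro k
    induction k with
    | zero => simp
    | succ k ih =>
      rw [sum_range_succ, sum_range_succ, ih, pairing_sub, pairing_sub_left]; ring
  have hsumG : ∑ t ∈ range n, pairing (G (t + 1) - G t) (c (t + 1)) ≤ Ψ * (V + 2) := by
    rw [htel]
    have h1 := (abs_le.1 (hGc n (by omega))).2
    have h2 := (abs_le.1 (hGc 0 (by omega))).1
    have h3 : -(Ψ * V) ≤ ∑ t ∈ range n, pairing (G t) (c (t + 1) - c t) := by
      rw [hV, mul_sum, ← sum_neg_distrib]
      exact sum_le_sum fun t ht => (abs_le.1 (hGd t (mem_range.1 ht))).1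
    linarith
  have hstep : η * ∑ t ∈ range n, pairing (mdVec (n + 1) δ ℓ h (g t) t)
      (iterate p ρ h pol t - c t) ≤
      Ψ * (V + 2) + n * (η * (N * κ)) ^ 2 + 2 * (η * (N * κ)) * V := by
    rw [mul_sum]
    refine (sum_le_sum fun t ht => pairing_step_le hp hρ hpol hπc hη hκ
      (by have := mem_range.1 ht; omega) hrule (fun t ht => (hreg t ht).1)
      (hfeas (t + 1) (by have := mem_range.1 ht; omega))
      (hz t (by have := mem_range.1 ht; omega))).trans ?_
    rw [sum_add_distrib, sum_add_distrib, ← mul_sum, sum_const, card_range, nsmul_eq_mul]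
    linarith
  -- The last episode has no successor whose optimality could be used, so it gets the trivial bound.
  have hlast : pairing (mdVec (n + 1) δ ℓ h (g n) n) (iterate p ρ h pol n - c n) ≤ N * κ * 2 :=
    (le_abs_self _).trans (abs_pairing_le _ _ hκ (hz n (by omega)) fun i =>
      l1_sub_le_two (occ_mem (isKernel_empKernel h n) (hpol n (by omega)) (hνm n (by omega)) _)
        (hcm n (by omega) _))
  have hdiv : ∑ t ∈ range n, pairing (mdVec (n + 1) δ ℓ h (g t) t) (iterate p ρ h pol t - c t) ≤
      Ψ * (V + 2) / η + n * η * (N * κ) ^ 2 + 2 * (N * κ) * V := by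
    rw [mul_comm, ← le_div_iff₀ hη] at hstep
    refine hstep.trans (le_of_eq ?_)
    field_simp
  rw [regretMD, sum_range_succ]
  linarith

/-- The trivial bound on the regret. -/
lemma regretMD_le_trivial [Nonempty X] {πc : Fin N → X → A → ℝ} {κ : ℝ} (hp : IsKernel p)
    (hρ : ρ ∈ stdSimplex ℝ (X × A)) (hpol : ∀ t < T, IsPolicy (pol t)) (hπc : IsPolicy πc)
    (hκ : 0 ≤ κ) (hz : ∀ t < T, ∀ i y, |mdVec T δ ℓ h (g t) t i y| ≤ κ) :
    regretMD T δ ℓ p ρ h pol g πc ≤ 2 * (N * κ) * T := by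
  have : ∀ t ∈ range T, pairing (mdVec T δ ℓ h (g t) t)
      (iterate p ρ h pol t - occ (empKernel h t) πc (initDist p ρ pol t)) ≤ N * κ * 2 := by
    intro t ht
    have ht' := mem_range.1 ht
    have hν := initDist_mem hp hρ hpol ht'.le
    exact (le_abs_self _).trans (abs_pairing_le _ _ hκ (hz t ht') fun i =>
      l1_sub_le_two (occ_mem (isKernel_empKernel h t) (hpol t ht') hν _)
        (occ_mem (isKernel_empKernel h t) hπc hν _))
  refine (sum_le_sum this).trans (le_of_eq ?_)
  rw [sum_const, card_range, nsmul_eq_mul]; ring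

end RegretBound

/-! ### Choice of the step size and form of the rate. -/

section Tuning

/-- Optimization of the step size. -/
lemma le_of_tuned_step {κ Ψ W T V R η : ℝ} (hκ : 0 < κ) (hΨ : 1 / 16 ≤ Ψ) (hW : 0 < W) (hT : 1 ≤ T)
    (hV : V + 2 ≤ W) (hη : η = √(Ψ * W / T) / κ)
    (h1 : R ≤ Ψ * (V + 2) / η + T * η * κ ^ 2 + 2 * κ * (V + 1)) (h2 : R ≤ 2 * κ * T) :
    R ≤ 10 * κ * √(Ψ * W * T) := by
  have hΨ0 : 0 < Ψ := by linarith
  have hT0 : 0 < T := by linarith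
  set s := √(Ψ * W * T) with hs
  have hs0 : 0 < s := Real.sqrt_pos.2 (by positivity)
  have hs2 : s ^ 2 = Ψ * W * T := Real.sq_sqrt (by positivity)
  have hηs : η = s / (T * κ) := by
    have : √(Ψ * W / T) = s / T := by
      rw [hs, Real.sqrt_eq_iff_mul_self_eq_of_pos (by positivity)]
      rw [← hs]
      field_simp
      rw [hs2]; ring
    rw [hη, this]; field_simp
  -- The lower bound on `Ψ` enters here: terms without `Ψ` are absorbed into the rate.
  have hlow : √(W * T) ≤ 4 * s := by
    have : √(W * T) ≤ √(16 * (Ψ * W * T)) := by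
      refine Real.sqrt_le_sqrt ?_
      have := mul_pos hW hT0
      nlinarith
    rwa [Real.sqrt_mul (by norm_num : (0 : ℝ) ≤ 16), show (16 : ℝ) = 4 ^ 2 by norm_num,
      Real.sqrt_sq (by norm_num), ← hs] at this
  -- If `W ≤ T`, the first two terms are at most `κ * s` each and `W ≤ √(W * T)` handles the linear
  -- one. Otherwise `T ≤ √(W * T)` and the trivial bound suffices.
  rcases le_total W T with hWT | hWT
  · have hW' : W ≤ √(W * T) := Real.le_sqrt_of_sq_le (by nlinarith)
    have e1 : Ψ * (V + 2) / η ≤ κ * s := by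
      have hη0 : 0 < η := by rw [hηs]; positivity
      rw [div_le_iff₀ hη0, hηs]
      have : κ * s * (s / (T * κ)) = Ψ * W := by
        field_simp; rw [hs2]; ring
      rw [this]
      exact mul_le_mul_of_nonneg_left hV hΨ0.le
    have e2 : T * η * κ ^ 2 = κ * s := by rw [hηs]; field_simp
    have e3 : 2 * κ * (V + 1) ≤ 2 * κ * (4 * s) :=
      mul_le_mul_of_nonneg_left (by linarith) (by positivity)
    linarith
  · have hT' : T ≤ √(W * T) := Real.le_sqrt_of_sq_le (by nlinarith)
    have e3 : 2 * κ * T ≤ 2 * κ * (4 * s) :=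
      mul_le_mul_of_nonneg_left (by linarith) (by positivity)
    have := mul_pos hκ hs0
    linarith

lemma rpow_quarter_pow {x : ℝ} (hx : 0 ≤ x) : (x ^ (1 / 4 : ℝ)) ^ 4 = x := by
  rw [← Real.rpow_natCast, ← Real.rpow_mul hx]; norm_num

/-- One factor `C` comes from the loss and one from the drift, and `C ^ 2 = 2 * S * Λ` yields the
full power of `S`; the root of the drift gives the fourth roots. The constant comes from `√108 ≤ 11`
and `√Λ ≤ 2 * Λ`. -/
lemma rate_le {S A N T ℓ α Ψ Λ C : ℝ} (hS : 0 < S) (hA : 0 < A) (hN : 0 ≤ N) (hT : 0 < T)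
    (hℓ : 0 ≤ ℓ) (hα : α < 1) (hΨ : 0 ≤ Ψ) (hΛ : 1 / 2 ≤ Λ) (hC0 : 0 ≤ C) (hC : C ^ 2 = 2 * S * Λ) :
    10 * (N * (ℓ * (N * C))) *
      √(Ψ * (108 * (N ^ 2 * C ^ 2 * √(S * A * T) * Λ) / (1 - α)) * T) ≤
    500 * (ℓ * N ^ 3 * S ^ (5 / 4 : ℝ) * A ^ (1 / 4 : ℝ) * √(Ψ / (1 - α)) * T ^ (3 / 4 : ℝ)) *
      Λ ^ 2 := by
  set s := S ^ (1 / 4 : ℝ) with hs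
  set a := A ^ (1 / 4 : ℝ) with ha
  set t := T ^ (1 / 4 : ℝ) with ht
  have hs0 : 0 ≤ s := Real.rpow_nonneg hS.le _
  have ha0 : 0 ≤ a := Real.rpow_nonneg hA.le _
  have ht0 : 0 ≤ t := Real.rpow_nonneg hT.le _
  have hs4 : s ^ 4 = S := rpow_quarter_pow hS.le
  have ha4 : a ^ 4 = A := rpow_quarter_pow hA.le
  have ht4 : t ^ 4 = T := rpow_quarter_pow hT.le
  have e1 : S ^ (5 / 4 : ℝ) = S * s := by
    rw [hs, ← Real.rpow_one_add' hS.le (by norm_num)]; norm_num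
  have e2 : T ^ (3 / 4 : ℝ) = t ^ 3 := by
    rw [ht, ← Real.rpow_natCast, ← Real.rpow_mul hT.le]; norm_num
  have e3 : √(S * A * T) = (s * a * t) ^ 2 := by
    rw [← hs4, ← ha4, ← ht4, show s ^ 4 * a ^ 4 * t ^ 4 = ((s * a * t) ^ 2) ^ 2 by ring,
      Real.sqrt_sq (by positivity)]
  have e4 : √(Ψ * (108 * (N ^ 2 * C ^ 2 * √(S * A * T) * Λ) / (1 - α)) * T) ≤
      √(Ψ / (1 - α)) * (11 * (N * C * (s * a * t ^ 3)) * √Λ) := by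
    rw [e3]
    apply Real.sqrt_le_iff.2
    refine ⟨by positivity, ?_⟩
    rw [mul_pow √(Ψ / (1 - α)), mul_pow (11 * _) √Λ, Real.sq_sqrt (by linarith : 0 ≤ Λ),
      Real.sq_sqrt (div_nonneg hΨ (by linarith))]
    have : Ψ * (108 * (N ^ 2 * C ^ 2 * (s * a * t) ^ 2 * Λ) / (1 - α)) * T =
        Ψ / (1 - α) * (108 * (N * C * (s * a * t ^ 3)) ^ 2 * Λ) := by
      rw [← ht4]; ring
    rw [this]
    refine mul_le_mul_of_nonneg_left ?_ (div_nonneg hΨ (by linarith))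
    have h0 : 0 ≤ (N * C * (s * a * t ^ 3)) ^ 2 * Λ := mul_nonneg (sq_nonneg _) (by linarith)
    nlinarith
  have e5 : √Λ ≤ 2 * Λ := by
    apply Real.sqrt_le_iff.2
    exact ⟨by linarith, by nlinarith⟩
  rw [e1, e2]
  set w := √(Ψ / (1 - α))
  have hw : 0 ≤ w := Real.sqrt_nonneg _
  calc _ ≤ 10 * (N * (ℓ * (N * C))) * (w * (11 * (N * C * (s * a * t ^ 3)) * (2 * Λ))) := by
        refine mul_le_mul_of_nonneg_left (e4.trans ?_) (by positivity)
        gcongr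
    _ = 220 * (ℓ * N ^ 3 * s * a * w * t ^ 3) * Λ * C ^ 2 := by ring
    _ = 440 * (ℓ * N ^ 3 * (S * s) * a * w * t ^ 3) * Λ ^ 2 := by rw [hC]; ring
    _ ≤ _ := by gcongr; norm_num

end Tuning

/-! ### Assembly on the good event. -/

section Main

variable {X A : Type*} [Fintype X] [Nonempty X] [Fintype A] {N T : ℕ} {δ ℓ α Ψ : ℝ}

/-- The step size. -/
noncomputable def stepSize (X A : Type*) [Fintype X] [Fintype A] (N T : ℕ) (ℓ α Ψ δ : ℝ) : ℝ :=
  -- The factor beginning with 108, divided by `1 - α`, is the a priori bound for the total drift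
  -- plus 2.
  √(Ψ * (108 * ((N : ℝ) ^ 2 * bonusConst X A N T δ ^ 2 *
    √((Fintype.card X : ℝ) * Fintype.card A * T) *
    Real.log ((Fintype.card X : ℝ) * Fintype.card A * N * T / δ)) / (1 - α)) / T) /
    (N * (ℓ * (N * bonusConst X A N T δ)))

/-- With one action there is only one policy, so iterate and comparator coincide. -/
lemma regretMD_eq_zero [Subsingleton A] {p : Fin N → X × A → X → ℝ} {ρ : X × A → ℝ}
    {h : ℕ → Fin (N + 1) → X × A} {pol : ℕ → Fin N → X → A → ℝ} {g : ℕ → Fin N → X × A → ℝ}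
    {π : Fin N → X → A → ℝ} (hpol : ∀ t < T, IsPolicy (pol t)) (hπ : IsPolicy π) :
    regretMD T δ ℓ p ρ h pol g π = 0 := by
  refine sum_eq_zero fun t ht => ?_
  have huniq : ∀ w ∈ stdSimplex ℝ A, ∀ a, w a = 1 := fun w hw a => by
    rw [← hw.2, Fintype.sum_subsingleton _ a]
  have : pol t = π := by
    ext i x a
    rw [huniq _ (hpol t (mem_range.1 ht) i x), huniq _ (hπ i x)]
  rw [iterate, this, pairing_sub, sub_self]

/-- The regret bound on the event where the empirical kernels are accurate and the bonuses are
summable. -/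
lemma regretMD_le_rate {D : Div} {η : ℝ} {p : Fin N → X × A → X → ℝ} {ρ : X × A → ℝ}
    {h : ℕ → Fin (N + 1) → X × A} {pol : ℕ → Fin N → X → A → ℝ} {g : ℕ → Fin N → X × A → ℝ}
    {π : Fin N → X → A → ℝ} (hA : 2 ≤ Fintype.card A) (hN : 1 ≤ N) (hT : 1 ≤ T) (hℓ : 0 ≤ ℓ)
    (hα0 : 0 ≤ α) (hα1 : α < 1) (hδ0 : 0 < δ) (hδ1 : δ < 1)
    (hη : 0 < stepSize X A N T ℓ α Ψ δ → η = stepSize X A N T ℓ α Ψ δ)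
    (hp : IsKernel p) (hρ : ρ ∈ stdSimplex ℝ (X × A)) (hcon : Contracts p ρ α)
    (hpol : ∀ t < T, IsPolicy (pol t)) (hg : ∀ t < T, ∀ i y, |g t i y| ≤ ℓ)
    (hrule : FollowsRule D T δ ℓ α η p ρ h pol g)
    (hK : ∀ t < T, ∀ i y, l1 (p i y - empKernel h t i y) ≤ bonus T δ h t i.castSucc y)
    (hM : ∑ t ∈ range T, expInvSqrt p h t (pol t) (initDist p ρ pol t) ≤
      2 * N * (3 * √((Fintype.card X : ℝ) * Fintype.card A * T) + Real.log (1 / δ)))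
    (hreg : ∀ t < T, D.Regular (iterate p ρ h pol t) (pol t) ∧
      norm1inf (D.grad (iterate p ρ h pol t) (pol t)) ≤ Ψ)
    (hπ : IsPeriodic p ρ π) :
    regretMD T δ ℓ p ρ h pol g π ≤
      500 * (ℓ * (N : ℝ) ^ 3 * (Fintype.card X : ℝ) ^ (5 / 4 : ℝ) *
        (Fintype.card A : ℝ) ^ (1 / 4 : ℝ) * √(Ψ / (1 - α)) * (T : ℝ) ^ (3 / 4 : ℝ)) *
        Real.log ((Fintype.card X : ℝ) * (Fintype.card A : ℝ) * (N : ℝ) * (T : ℝ) / δ) ^ 2 := by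
  have hS1 : (1 : ℝ) ≤ Fintype.card X := by exact_mod_cast (Fintype.card_pos : 0 < Fintype.card X)
  have hA2 : (2 : ℝ) ≤ Fintype.card A := by exact_mod_cast hA
  have hN1 : (1 : ℝ) ≤ N := by exact_mod_cast hN
  have hT1 : (1 : ℝ) ≤ T := by exact_mod_cast hT
  have hν : ∀ t < T, initDist p ρ pol t ∈ stdSimplex ℝ (X × A) := fun t ht =>
    initDist_mem hp hρ hpol ht.le
  have hfeas : ∀ t < T, occ (empKernel h t) π (initDist p ρ pol t) ∈
      constraintSet T δ α ρ (initDist p ρ pol t) h t := fun t ht =>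
    occ_mem_constraintSet hp hρ hcon hπ (hν t ht) (hK t ht)
  have hΨ : 1 / 16 ≤ Ψ := (le_norm1inf_grad (isKernel_empKernel h 0) (hpol 0 hT) (hν 0 hT) hA hN
    (hreg 0 hT).1).trans (hreg 0 hT).2
  unfold stepSize at hη
  set S : ℝ := (Fintype.card X : ℝ)
  set a : ℝ := (Fintype.card A : ℝ)
  set Λ := Real.log (S * a * N * T / δ) with hΛ
  set Q := √(S * a * T) with hQ
  set C := bonusConst X A N T δ with hC
  have hNT : (1 : ℝ) ≤ N * T := one_le_mul_of_one_le_of_one_le hN1 hT1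
  have hSANT : 2 ≤ S * a * N * T := by
    have : (2 : ℝ) ≤ S * a := by nlinarith
    nlinarith
  have hΛ1 : 1 / 2 ≤ Λ := by
    have h1 : Real.log 2 ≤ Λ := Real.log_le_log (by norm_num) (by
      rw [le_div_iff₀ hδ0]; nlinarith)
    have := Real.log_two_gt_d9
    linarith
  have hlogδ : Real.log (1 / δ) ≤ Λ := Real.log_le_log (by positivity)
    (div_le_div_of_nonneg_right (by linarith) hδ0.le)
  have hC2 : C ^ 2 = 2 * S * Λ := by
    rw [hC, bonusConst, Real.sq_sqrt (by positivity)]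
  have hC0 : 0 ≤ C := Real.sqrt_nonneg _
  have hC1 : 1 ≤ C := by
    refine (one_le_sq_iff₀ hC0).1 ?_
    rw [hC2, mul_comm 2 S, mul_assoc]
    exact one_le_mul_of_one_le_of_one_le hS1 (by linarith)
  have hQ1 : 1 ≤ Q := Real.one_le_sqrt.2 (by
    have : (1 : ℝ) ≤ S * a := by nlinarith
    exact one_le_mul_of_one_le_of_one_le this hT1)
  set κ := ℓ * (N * C) with hκ
  have hκ0 : 0 ≤ κ := by positivity
  have hz : ∀ t < T, ∀ i y, |mdVec T δ ℓ h (g t) t i y| ≤ κ := fun t ht =>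
    abs_mdVec_le hℓ hC1 (hg t ht) t
  have htriv := regretMD_le_trivial hp hρ hpol hπ.1 hκ0 hz
  refine le_trans ?_ (rate_le (by linarith) (by linarith) (by linarith) (by linarith) hℓ hα1
    (by linarith) hΛ1 (by linarith) hC2)
  set U := (N : ℝ) ^ 2 * C ^ 2 * Q * Λ with hU
  -- For `ℓ = 0` the tuned step size degenerates, but the trivial bound is already zero.
  rcases hℓ.eq_or_lt with hℓ0 | hℓ0
  · have : κ = 0 := by rw [hκ, ← hℓ0, zero_mul]
    rw [this] at htriv
    simpa [← hℓ0] using htriv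
  have hκ1 : 0 < N * κ := by positivity
  have h1α : 0 < 1 - α := by linarith
  have hU0 : 0 < U := by positivity
  have hW0 : 0 < 108 * U / (1 - α) := by positivity
  have hη' : η = √(Ψ * (108 * U / (1 - α)) / T) / (N * κ) := hη (by positivity)
  have hη0 : 0 < η := by rw [hη']; positivity
  obtain ⟨n, rfl⟩ := Nat.exists_eq_add_of_le' hT
  have hbound := regretMD_le (Ψ := Ψ) hp hρ hpol hπ.1 hη0 hκ0 hrule hreg hfeas hz
  have hexp0 : ∀ t < n + 1, 0 ≤ expInvSqrt p h t (pol t) (initDist p ρ pol t) := fun t ht =>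
    sum_nonneg fun i _ => sum_nonneg fun y _ =>
      mul_nonneg ((occ_mem hp (hpol t ht) (hν t ht) _).1 y) (invSqrtVisits_nonneg _ _ _ _)
  -- The absolute value makes `m` nonnegative at all indices, including those beyond the horizon,
  -- where the policies are not controlled.
  set m : ℕ → ℝ := fun t => (2 + N * C) *
    (C * |expInvSqrt p h t (pol t) (initDist p ρ pol t)|) with hm
  have hdrift := sum_drift_le (h := h) (m := m) hp hρ hpol hα0 hα1
    (fun t => by simp only [hm]; positivity) (fun t ht1 htn => by
      have := l1_terminal_sub_le hp (hpol t (by omega)) (hν t (by omega)) (hK t (by omega))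
        (ρ := ρ) (α := α) ?_
      · simp only [hm]
        rw [abs_of_nonneg (hexp0 t (by omega))]
        exact this
      -- The constraint of episode `t` is enforced by the update from `t - 1`, whose constraint set
      -- contains the comparator.
      · obtain ⟨s, rfl⟩ := Nat.exists_eq_add_of_le' ht1
        exact (hrule s (by omega) (hreg s (by omega)).1 ⟨_, hfeas (s + 1) (by omega)⟩).1)
  have hmsum : ∑ t ∈ range n, m t ≤ 42 * U := by
    have h1 : ∑ t ∈ range n, m t = (2 + N * C) * (C *
        ∑ t ∈ range n, expInvSqrt p h t (pol t) (initDist p ρ pol t)) := by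
      simp only [hm, mul_sum]
      refine sum_congr rfl fun t ht => ?_
      rw [abs_of_nonneg (hexp0 t (by have := mem_range.1 ht; omega))]
    have h2 : ∑ t ∈ range n, expInvSqrt p h t (pol t) (initDist p ρ pol t) ≤
        2 * N * (3 * Q + Real.log (1 / δ)) := by
      rw [sum_range_succ] at hM
      have := hexp0 n (by omega)
      linarith
    have h3 : 3 * Q + Real.log (1 / δ) ≤ 7 * (Q * Λ) := by
      have h5 : Q * (1 / 2) ≤ Q * Λ := mul_le_mul_of_nonneg_left hΛ1 (by linarith)
      have h6 : 1 * Λ ≤ Q * Λ := mul_le_mul_of_nonneg_right hQ1 (by linarith)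
      linarith
    have h4 : 2 + N * C ≤ 3 * (N * C) := by
      have : (1 : ℝ) ≤ N * C := one_le_mul_of_one_le_of_one_le hN1 hC1
      linarith
    have h5 := h2.trans (mul_le_mul_of_nonneg_left h3 (by positivity))
    rw [h1, hU, show 42 * ((N : ℝ) ^ 2 * C ^ 2 * Q * Λ) =
      (3 * (N * C)) * (C * (2 * N * (7 * (Q * Λ)))) by ring]
    refine mul_le_mul h4 (mul_le_mul_of_nonneg_left h5 hC0) (mul_nonneg hC0 (sum_nonneg fun t ht =>
      hexp0 t ?_)) (by positivity)
    have := mem_range.1 ht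
    omega
  have hNC : 1 ≤ (N : ℝ) ^ 2 * C ^ 2 :=
    one_le_mul_of_one_le_of_one_le (one_le_pow₀ hN1) (one_le_pow₀ hC1)
  have hQΛ' : Q * (1 / 2) ≤ Q * Λ := mul_le_mul_of_nonneg_left hΛ1 (by linarith)
  have h2U : 2 ≤ 4 * U := by
    have : 1 * (1 / 2) ≤ (N : ℝ) ^ 2 * C ^ 2 * (Q * Λ) := mul_le_mul hNC (by linarith) (by norm_num)
      (by positivity)
    rw [hU]; linarith
  have hNQ : 6 * N * Q ≤ 12 * U := by
    have h1 : (N : ℝ) ≤ N ^ 2 * C ^ 2 := by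
      rw [pow_two, mul_assoc]
      exact le_mul_of_one_le_right (by linarith)
        (one_le_mul_of_one_le_of_one_le hN1 (one_le_pow₀ hC1))
    have h2 : Q ≤ 2 * (Q * Λ) := by linarith
    have := mul_le_mul h1 h2 (by linarith) (by positivity)
    rw [hU]; linarith
  have hUα : U ≤ U / (1 - α) := le_div_self hU0.le h1α (by linarith)
  -- The constant is `108 = 2 * 46 + 12 + 4`: the initial distributions, with `46 = 42 + 4`, then
  -- the empirical kernels, and the added 2.
  have hV : ∑ t ∈ range n, drift p ρ h pol t + 2 ≤ 108 * U / (1 - α) := by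
    have h1 : (2 + ∑ t ∈ range n, m t) / (1 - α) ≤ 46 * (U / (1 - α)) := by
      rw [← mul_div_assoc]
      exact div_le_div_of_nonneg_right (by linarith) h1α.le
    rw [mul_div_assoc]
    linarith
  refine le_of_tuned_step hκ1 hΨ hW0 hT1 hV hη' (hbound.trans ?_) htriv
  have : (n : ℝ) * η * (N * κ) ^ 2 ≤ (n + 1 : ℕ) * η * (N * κ) ^ 2 := by
    gcongr; simp
  linarith

end Main

end PeriodicMDP

theorem mainTheorem4 :
    ∃ (C : ℝ) (k : ℕ), 0 < C ∧
      ∀ (X A : Type*) [Fintype X] [Nonempty X] [Fintype A] [Nonempty A] (D : PeriodicMDP.Div)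
        (N T : ℕ) (ℓ α Ψ δ : ℝ), 1 ≤ N → 1 ≤ T → 0 ≤ ℓ → 0 ≤ α → α < 1 → 0 ≤ Ψ → 0 < δ → δ < 1 →
      ∃ η : ℝ, 0 < η ∧
      ∀ (p : Fin N → X × A → X → ℝ) (ρ : X × A → ℝ),
        PeriodicMDP.IsKernel p → ρ ∈ stdSimplex ℝ (X × A) → PeriodicMDP.Contracts p ρ α →
      ∀ (Ω : Type*) [mΩ : MeasurableSpace Ω] (P : MeasureTheory.Measure Ω)
        [MeasureTheory.IsProbabilityMeasure P] (ℱ : MeasureTheory.Filtration ℕ mΩ)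
        (traj : ℕ → Ω → Fin (N + 1) → X × A) (pol : ℕ → Ω → Fin N → X → A → ℝ)
        (f : ℕ → Ω → Fin N → (X × A → ℝ) → ℝ) (g : ℕ → Ω → Fin N → X × A → ℝ),
        PeriodicMDP.IsObservation P ℱ T p ρ traj pol →
        (∀ ω, PeriodicMDP.IsLoss ℓ T (fun t => f t ω)) →
        (∀ ω, ∀ t < T, ∀ i : Fin N, PeriodicMDP.IsSubgradient (f t ω i)
          (PeriodicMDP.iterate p ρ (fun s => traj s ω) (fun s => pol s ω) t i.succ) (g t ω i)) →
        (∀ ω, PeriodicMDP.FollowsRule D T δ ℓ α η p ρ (fun s => traj s ω) (fun s => pol s ω)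
          (fun s => g s ω)) →
      ∃ E : Set Ω, MeasurableSet E ∧ ENNReal.ofReal (1 - 3 * δ) ≤ P E ∧
        ∀ ω ∈ E,
          (∀ t < T,
            D.Regular (PeriodicMDP.iterate p ρ (fun s => traj s ω) (fun s => pol s ω) t)
              (pol t ω) ∧
            PeriodicMDP.norm1inf
              (D.grad (PeriodicMDP.iterate p ρ (fun s => traj s ω) (fun s => pol s ω) t)
                (pol t ω)) ≤ Ψ) →
          ∀ π, PeriodicMDP.IsPeriodic p ρ π →
            PeriodicMDP.regretMD T δ ℓ p ρ (fun s => traj s ω) (fun s => pol s ω)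
              (fun s => g s ω) π ≤
            C * (ℓ * (N : ℝ) ^ 3 * (Fintype.card X : ℝ) ^ (5 / 4 : ℝ) *
              (Fintype.card A : ℝ) ^ (1 / 4 : ℝ) * √(Ψ / (1 - α)) * (T : ℝ) ^ (3 / 4 : ℝ)) *
              Real.log ((Fintype.card X : ℝ) * (Fintype.card A : ℝ) * (N : ℝ) * (T : ℝ) / δ) ^ k := by
  refine ⟨500, 2, by norm_num, ?_⟩
  intro X A _ _ _ _ D N T ℓ α Ψ δ hN hT hℓ hα0 hα1 hΨ hδ0 hδ1
  -- The tuned step vanishes in degenerate cases such as `ℓ = 0` or `Ψ = 0`; any positive value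
  -- serves there.
  refine ⟨if 0 < PeriodicMDP.stepSize X A N T ℓ α Ψ δ then
    PeriodicMDP.stepSize X A N T ℓ α Ψ δ else 1, by split_ifs <;> [assumption; norm_num], ?_⟩
  intro p ρ hp hρ hcon Ω mΩ P _ ℱ traj pol f g hobs hf hg hrule
  have hA1 : 1 ≤ Fintype.card A := Fintype.card_pos
  rcases hA1.eq_or_lt with hA | hA
  · have hs : Subsingleton A := Fintype.card_le_one_iff_subsingleton.1 hA.ge
    refine ⟨Set.univ, MeasurableSet.univ, ?_, fun ω _ _ π hπ => ?_⟩
    · rw [measure_univ]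
      exact ENNReal.ofReal_le_one.2 (by linarith)
    · rw [PeriodicMDP.regretMD_eq_zero (fun t ht => hobs.isPolicy t ht ω) hπ.1]
      positivity
  · obtain ⟨B₁, hB₁, hK⟩ := PeriodicMDP.exists_kernel_event hp hρ hobs hA hN hT hδ0 hδ1
    obtain ⟨B₂, hB₂, hM⟩ := PeriodicMDP.exists_bonus_event hp hρ hobs hN hδ0
    -- The bad sets need not be measurable, since the losses and policies are bounded pathwise
    -- outside them; a measurable hull of the same measure is removed.
    refine ⟨(toMeasurable P (B₁ ∪ B₂))ᶜ, (measurableSet_toMeasurable _ _).compl, ?_,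
      fun ω hω hreg π hπ => ?_⟩
    · rw [prob_compl_eq_one_sub (measurableSet_toMeasurable _ _), measure_toMeasurable,
        ENNReal.ofReal_sub _ (by linarith), ENNReal.ofReal_one]
      refine tsub_le_tsub_left ?_ _
      rw [ENNReal.le_ofReal_iff_toReal_le (measure_ne_top _ _) (by linarith)]
      exact (measureReal_union_le B₁ B₂).trans (by linarith)
    · have hω' : ω ∉ B₁ ∪ B₂ := fun h => hω (subset_toMeasurable _ _ h)
      exact PeriodicMDP.regretMD_le_rate hA hN hT hℓ hα0 hα1 hδ0 hδ1 (fun h => if_pos h) hp hρ hcon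
        (fun t ht => hobs.isPolicy t ht ω)
        (fun t ht i y => PeriodicMDP.abs_subgradient_le (hf ω t ht i).2 (hg ω t ht i) y)
        (hrule ω) (hK ω fun h => hω' (Or.inl h)) (hM ω fun h => hω' (Or.inr h)) hreg hπ
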